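/- **Setting.** A multicast network is a finite directed acyclic multigraph with a source node $s$ (without incoming edges) and a set $T$ of receivers; its source dimension is the out-degree of $s$. A linear network code over a field $F$ assigns a coefficient $k_{e',e}\in F$ to every pair $(e',e)$ of edges, with $k_{e',e}=0$ unless $e'$ ends at the node where $e$ starts. It determines coding vectors $f_e$: the outgoing edges of $s$ carry the unit vectors of $F^{\omega}$ ($\omega$ the source dimension), and $f_e=\sum_{e'}k_{e',e}f_{e'}$ for all other edges $e$. The network is linearly solvable over $F$ if for some linear network code the matrix $[f_e]_{e\in In(t)}$ has rank $\omega$ for every receiver $t$, where $In(t)$ is the set of edges entering $t$. Let $q_{\min}$ be the minimum size of a finite field over which the network is linearly solvable. For a set $N$ of non-source nodes, $maxflow(N)$ is the maximum number of edge-disjoint paths from $s$ to nodes in $N$. For an integer $\omega\ge 3$ and an $\omega$-tuple $\mathbf d=(d_1,\dots,d_\omega)$ of integers larger than $1$, let $\mathcal N_{\omega,\mathbf d}$ be the following multicast network: the source $s$; nodes $u_1,\dots,u_\omega$, each with a single edge from $s$; nodes $v_1,\dots,v_\omega$, where $v_i$ has one edge from $u_i$ and one from $u_{i-1}$ (with $u_0=u_\omega$);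 for each $i$, nodes $n_{i,1},\dots,n_{i,d_i}$, each with a single edge from $v_i$; and, for every set $N$ of $\omega$ of the nodes $n_{i,j}$ with $maxflow(N)=\omega$, one receiver with one edge from each node of $N$. **Theorem.** Let $\mathrm{GF}(q)$ and $\mathrm{GF}(q')$ be finite fields and let $G\ne\{1\}$ be a proper subgroup of $\mathrm{GF}(q)^\times$ such that for every proper subgroup $G'$ of $\mathrm{GF}(q')^\times$ at least one of $|G|>|G'|$ and $q-|G|>q'-|G'|$ holds. Write $d=|G|$, let $\omega\ge 3$ be an integer with $$\omega\ \ge\ \max\left\{\frac{\frac{q'-1}{d'}-\left\lceil\frac{q-d-1}{d'}\right\rceil}{\left\lceil\frac{d}{d'}\right\rceil-1}+1\ :\ 1\le d'<d,\ d'\mid q'-1\right\},$$ and let $\mathbf d=(d,\dots,d,q-d-1)$, with $\omega-1$ entries equal to $d$. Then $\mathcal N_{\omega,\mathbf d}$ is linearly solvable over $\mathrm{GF}(q)$ but not over $\mathrm{GF}(q')$. Moreover, $q_{\min}=q$ for $\mathcal N_{\omega,\mathbf d}$. -/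

import Mathlib

/-- A finite directed acyclic multigraph with nodes `V`, edges `E` and a distinguished source node,
which has no incoming edge. Parallel edges are allowed. -/
structure SourcedNetwork (V E : Type*) [Finite V] [Finite E] where
  /-- the node an edge leaves -/
  tail : E → V
  /-- the node an edge enters -/
  head : E → V
  source : V
  head_ne_source : ∀ e, head e ≠ source
  acyclic : ∀ v, ¬ Relation.TransGen (fun a b => ∃ e, tail e = a ∧ head e = b) v v

/-- A (single-source) multicast network: a network with a source and a set of receivers. -/
structure MulticastNetwork (V E : Type*) [Finite V] [Finite E] extends SourcedNetwork V E where
  receivers : Set V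

namespace SourcedNetwork

variable {V E : Type*} [Finite V] [Finite E]

/-- `p` lists the consecutive edges of a directed path that starts at the source and ends at a node
in `N`. -/
def IsPathTo (𝒩 : SourcedNetwork V E) (N : Set V) (p : List E) : Prop :=
  p.IsChain (fun a b => 𝒩.head a = 𝒩.tail b) ∧
    (∃ e ∈ p.head?, 𝒩.tail e = 𝒩.source) ∧ ∃ e ∈ p.getLast?, 𝒩.head e ∈ N

/-- There are `k` pairwise edge-disjoint paths starting at the source and ending at nodes in `N`. -/
def HasDisjointPaths (𝒩 : SourcedNetwork V E) (N : Set V) (k : ℕ) : Prop :=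
  ∃ P : Fin k → List E, (∀ i, 𝒩.IsPathTo N (P i)) ∧ Pairwise fun i j => (P i).Disjoint (P j)

/-- The maximum number of edge-disjoint paths starting at the source and ending at nodes in `N`
(a set of non-source nodes). -/
noncomputable def maxflow (𝒩 : SourcedNetwork V E) (N : Set V) : ℕ :=
  sSup {k | 𝒩.HasDisjointPaths N k}

/-- The numbers of edge-disjoint paths are bounded, so the supremum in `maxflow` is a maximum. -/
theorem bddAbove_hasDisjointPaths (𝒩 : SourcedNetwork V E) (N : Set V) :
    BddAbove {k | 𝒩.HasDisjointPaths N k} := by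
  refine ⟨Nat.card E, ?_⟩
  rintro k ⟨P, hP, hd⟩
  have h : ∀ i, ∃ e, e ∈ P i := fun i => by
    obtain ⟨-, ⟨e, he, -⟩, -⟩ := hP i
    exact ⟨e, List.mem_of_mem_head? he⟩
  choose g hg using h
  have hinj : Function.Injective g := fun i j hij => by
    by_contra hne
    exact hd hne (hg i) (hij ▸ hg j)
  simpa using Nat.card_le_card_of_injective g hinj

/-- The outgoing edges of the source. Their number is the source dimension. -/
abbrev SourceEdge (𝒩 : SourcedNetwork V E) : Type _ := {e : E // 𝒩.tail e = 𝒩.source}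

/-- A linear network code over `F`: a coding coefficient for every pair of edges, which is zero
unless the pair is adjacent. -/
structure LinearCode (𝒩 : SourcedNetwork V E) (F : Type*) [Field F] where
  coeff : E → E → F
  coeff_eq_zero : ∀ d e, 𝒩.head d ≠ 𝒩.tail e → coeff d e = 0

open Classical in
/-- `f` is the family of coding vectors of a linear network code: the outgoing edges of the source
carry the unit vectors, and the vector of any other edge is the combination, given by the coding
coefficients, of the vectors of the edges entering its tail. As the network is acyclic, `f` is
determined by the code. -/
def LinearCode.IsCodingVectors {𝒩 : SourcedNetwork V E} {F : Type*} [Field F]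
    [Fintype E] (c : 𝒩.LinearCode F) (f : E → 𝒩.SourceEdge → F) : Prop :=
  (∀ e : 𝒩.SourceEdge, f e = Pi.single e 1) ∧
    ∀ e, 𝒩.tail e ≠ 𝒩.source → f e = ∑ d, c.coeff d e • f d

end SourcedNetwork

namespace MulticastNetwork

variable {V E : Type*} [Finite V] [Finite E]

open Classical in
/-- A multicast network is linearly solvable over `F` if some linear network code over `F` is such
that for each receiver `t` the matrix whose columns are the coding vectors of the edges entering `t`
has full rank, the source dimension. -/
def LinearlySolvable [Fintype E] (𝒩 : MulticastNetwork V E) (F : Type*) [Field F] : Prop :=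
  ∃ (c : 𝒩.LinearCode F) (f : E → 𝒩.SourceEdge → F), c.IsCodingVectors f ∧
    ∀ t ∈ 𝒩.receivers,
      (Matrix.of fun (o : 𝒩.SourceEdge) (e : {e : E // 𝒩.head e = t}) => f e o).rank =
        Fintype.card 𝒩.SourceEdge

/-- `q` is the minimum size of a finite field over which the network has a linear solution. -/
def IsQMin [Fintype E] (𝒩 : MulticastNetwork V E) (q : ℕ) : Prop :=
  IsLeast {n | ∃ (F : Type) (_ : Field F) (_ : Finite F), Nat.card F = n ∧ 𝒩.LinearlySolvable F} q

end MulticastNetwork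

/-! ### The five-layer networks -/

/-- Nodes on layers 1 to 4. -/
inductive CoreNode (ω : ℕ) (d : Fin ω → ℕ) : Type
  | s : CoreNode ω d
  | u (i : Fin ω) : CoreNode ω d
  | v (i : Fin ω) : CoreNode ω d
  | n (i : Fin ω) (j : Fin (d i)) : CoreNode ω d
  deriving Fintype

/-- Edges among layers 1 to 4: `s → u i`, `u i → v i`, `u (i - 1) → v i` and `v i → n i j`. -/
inductive CoreEdge (ω : ℕ) (d : Fin ω → ℕ) : Type
  | su (i : Fin ω) : CoreEdge ω d
  | uv (i : Fin ω) : CoreEdge ω d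
  | uv' (i : Fin ω) : CoreEdge ω d
  | vn (i : Fin ω) (j : Fin (d i)) : CoreEdge ω d
  deriving Fintype

namespace CoreNode

/-- The layer of a node. -/
def layer {ω : ℕ} {d : Fin ω → ℕ} : CoreNode ω d → ℕ
  | s => 1
  | u _ => 2
  | v _ => 3
  | n _ _ => 4

end CoreNode

namespace CoreEdge

variable {ω : ℕ} {d : Fin ω → ℕ}

/-- The tail of an edge; `(finRotate ω).symm i` is the cyclic predecessor of the index `i`. -/
def tail : CoreEdge ω d → CoreNode ω d
  | su _ => .s
  | uv i => .u i
  | uv' i => .u ((finRotate ω).symm i)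
  | vn i _ => .v i

/-- The head of an edge. -/
def head : CoreEdge ω d → CoreNode ω d
  | su i => .u i
  | uv i => .v i
  | uv' i => .v i
  | vn i j => .n i j

theorem layer_head (e : CoreEdge ω d) : e.head.layer = e.tail.layer + 1 := by
  cases e <;> rfl

end CoreEdge

/-- A directed multigraph whose edges strictly increase a rank function has no directed cycle. -/
theorem not_transGen_self_of_rank {V E : Type*} (tail head : E → V) (r : V → ℕ)
    (h : ∀ e, r (tail e) < r (head e)) (v : V) :
    ¬ Relation.TransGen (fun a b => ∃ e, tail e = a ∧ head e = b) v v := by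
  intro hv
  have key : ∀ w, Relation.TransGen (fun a b => ∃ e, tail e = a ∧ head e = b) v w →
      r v < r w := by
    intro w hw
    induction hw with
    | single hab => obtain ⟨e, rfl, rfl⟩ := hab; exact h e
    | tail _ hab ih => obtain ⟨e, rfl, rfl⟩ := hab; exact ih.trans (h e)
  exact lt_irrefl _ (key v hv)

/-- The network on layers 1 to 4. -/
def coreNetwork (ω : ℕ) (d : Fin ω → ℕ) : SourcedNetwork (CoreNode ω d) (CoreEdge ω d) where
  tail := CoreEdge.tail
  head := CoreEdge.head
  source := .s
  head_ne_source e := by cases e <;> simp [CoreEdge.head]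
  acyclic := not_transGen_self_of_rank _ _ CoreNode.layer fun e => by simp [CoreEdge.layer_head]

/-- Nodes on layer 5: one for every set `N` of `ω` layer-4 nodes with `maxflow N = ω`. Layer-5 nodes
have no outgoing edges, so the maximum flow can be computed on layers 1 to 4. -/
abbrev ReceiverNode (ω : ℕ) (d : Fin ω → ℕ) : Type :=
  {N : Finset (Σ i : Fin ω, Fin (d i)) //
    N.card = ω ∧ (coreNetwork ω d).maxflow {x | ∃ p ∈ N, x = .n p.1 p.2} = ω}

/-- The nodes of the five-layer network. -/
abbrev FullNode (ω : ℕ) (d : Fin ω → ℕ) : Type := CoreNode ω d ⊕ ReceiverNode ω d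

/-- The edges of the five-layer network: those among layers 1 to 4, and one from each member of `N`
to the layer-5 node created for `N`. -/
abbrev FullEdge (ω : ℕ) (d : Fin ω → ℕ) : Type := CoreEdge ω d ⊕ (Σ N : ReceiverNode ω d, N.1)

noncomputable instance instFintypeFullEdge (ω : ℕ) (d : Fin ω → ℕ) : Fintype (FullEdge ω d) :=
  Fintype.ofFinite _

/-- The five-layer multicast network with source dimension `ω` and parameters `d`. -/
def fiveLayerNetwork (ω : ℕ) (d : Fin ω → ℕ) : MulticastNetwork (FullNode ω d) (FullEdge ω d) where
  tail := Sum.elim (fun e => .inl e.tail) fun x => .inl (.n x.2.1.1 x.2.1.2)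
  head := Sum.elim (fun e => .inl e.head) fun x => .inr x.1
  source := .inl .s
  head_ne_source := by
    rintro (e | x)
    · cases e <;> simp [CoreEdge.head]
    · simp
  acyclic := by
    refine not_transGen_self_of_rank _ _ (Sum.elim CoreNode.layer fun _ => 5) ?_
    rintro (e | x)
    · simp [CoreEdge.layer_head]
    · simp [CoreNode.layer]
  receivers := Set.range .inr

/-! ### The condition on subgroup orders -/

/-- The condition on a subgroup `G` of `Kˣ` relative to a finite field `K'`: for every proper
subgroup `G'` of `K'ˣ`, `|G| > |G'|` or `q - |G| > q' - |G'|`. -/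
def SubgroupOrderCondition {K : Type*} [Field K] (G : Subgroup Kˣ) (K' : Type*) [Field K'] : Prop :=
  ∀ G' : Subgroup K'ˣ, G' ≠ ⊤ →
    Nat.card G > Nat.card G' ∨
      (Nat.card K : ℤ) - Nat.card G > (Nat.card K' : ℤ) - Nat.card G'

/-- The `ω`-tuple `(d, …, d, q - d - 1)`. -/
def criterionTuple (ω q d : ℕ) (i : Fin ω) : ℕ := if (i : ℕ) + 1 = ω then q - d - 1 else d

/-! The edge from `v i` to `n i j` carries a combination of the unit vectors `e i` and `e (i - 1)`.
The receivers are the sets of `ω` layer-4 nodes that can be matched bijectively with the `u m`, a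
node `n i j` being matched with `u i` or `u (i - 1)`. Full rank at all of them forces both
coefficients to be nonzero, so up to scaling the vector is `e i - r i j • e (i - 1)`. It also forces
`r i` to be injective and no product `∏ i, r i (j i)` to be `1`; conversely these conditions
suffice. Solvability over `F` is thus the existence of sets of units of sizes `d i` whose product
set misses `1`.

Over `K`, take `G` for the first `ω - 1` sets and the complement of `G` for the last.

Over a finite field `F`, Kneser's theorem applies. Let `H` be the stabilizer of the product set, `h
= |H|` and `|Fˣ| = h * m`. The product set is a union of cosets of `H` and misses `H`, so `(ω - 1) *
⌈d / h⌉ + ⌈(q - d - 1) / h⌉ ≤ m + ω - 2`. If `h < d`, this contradicts the lower bound on `ω`. If `h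
≥ d`, it makes `H` proper with `q - d ≤ |F| - h`, against the condition on subgroup orders. When
`|F| < q`, both contradictions arise without further assumptions, which gives `q_min = q`.

Kneser's theorem is proved by way of convergent sets: among them one with smallest stabilizer is
chosen and, if the inequality fails, enlarged. -/

/-! ### Kneser's theorem -/

namespace Kneser

open scoped Pointwise
open MulAction

variable {G : Type*} [CommGroup G]

theorem mem_mul_subgroup {A : Set G} {H : Subgroup G} {x : G} :
    x ∈ A * (H : Set G) ↔ ∃ a ∈ A, a⁻¹ * x ∈ H := by
  constructor
  · rintro ⟨a, ha, h, hh, rfl⟩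
    exact ⟨a, ha, by simpa using hh⟩
  · rintro ⟨a, ha, h⟩
    exact ⟨a, ha, _, h, by simp⟩

theorem subset_mul_subgroup (A : Set G) (H : Subgroup G) : A ⊆ A * (H : Set G) :=
  fun a ha => mem_mul_subgroup.2 ⟨a, ha, by simp⟩

theorem mem_leftCoset {c x : G} {H : Subgroup G} : x ∈ c • (H : Set G) ↔ c⁻¹ * x ∈ H := by
  rw [Set.mem_smul_set_iff_inv_smul_mem]; rfl

theorem ncard_subgroup (H : Subgroup G) : (H : Set G).ncard = Nat.card H := rfl

theorem ncard_leftCoset (c : G) (H : Subgroup G) : (c • (H : Set G)).ncard = Nat.card H := by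
  rw [Set.ncard_smul_set, ncard_subgroup]

theorem card_dvd_ncard_mul (A : Set G) (H : Subgroup G) :
    Nat.card H ∣ (A * (H : Set G)).ncard := by
  have h := QuotientGroup.card_preimage_mk H ((QuotientGroup.mk : G → G ⧸ H) '' A)
  rw [QuotientGroup.preimage_image_mk_eq_mul, Nat.card_coe_set_eq] at h
  exact ⟨_, h⟩

theorem stabilizer_le_mul_right (A B : Set G) : stabilizer G A ≤ stabilizer G (A * B) := by
  intro g hg
  rw [mem_stabilizer_iff] at hg ⊢
  rw [← smul_mul_assoc, hg]

/-- The stabilizer of a set in a coset of `H` lies in `H`. -/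
theorem stabilizer_le_of_subset_leftCoset {D : Set G} {H : Subgroup G} {c : G} (hD : D.Nonempty)
    (hDc : D ⊆ c • (H : Set G)) : stabilizer G D ≤ H := by
  intro g hg
  obtain ⟨d, hd⟩ := hD
  have h1 := mem_leftCoset.1 (hDc hd)
  have h2 := mem_leftCoset.1 (hDc ((mem_stabilizer_set.1 hg d).2 hd))
  have h3 := H.mul_mem h2 (H.inv_mem h1)
  simpa [mul_assoc] using h3

/-- Adding a proper part of a coset of the stabilizer of `C` to `C`. -/
theorem stabilizer_union_of_ssubset_leftCoset {C D : Set G} {c : G} (hD : D.Nonempty)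
    (hDc : D ⊆ c • (stabilizer G C : Set G)) {x : G} (hx : x ∈ c • (stabilizer G C : Set G))
    (hxD : x ∉ D) (hcC : c ∉ C) : stabilizer G (C ∪ D) = stabilizer G D := by
  have hle := stabilizer_le_of_subset_leftCoset hD hDc
  have hdisj : ∀ y ∈ c • (stabilizer G C : Set G), y ∉ C := by
    intro y hy hyC
    have h1 := (mem_stabilizer_set.1 (mem_leftCoset.1 hy) c).1
    exact hcC (h1 (by simpa [mul_comm, mul_assoc] using hyC))
  -- If `g` preserves `C ∪ D` but not `C`, then `g⁻¹ * d` falls outside the coset of `c`, hence into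
  -- `C`. Since `d⁻¹ * x` stabilizes `C`, also `g⁻¹ * x ∈ C`, and applying `g` puts `x` into `C ∪
  -- D`.
  have hsub : stabilizer G (C ∪ D) ≤ stabilizer G C := by
    intro g hg
    by_contra hgH
    obtain ⟨d, hd⟩ := hD
    have hg' := inv_mem hg
    have hginv : ∀ y ∈ C ∪ D, g⁻¹ * y ∈ C ∪ D := fun y hy => (mem_stabilizer_set.1 hg' y).2 hy
    have hmem : ∀ y ∈ C ∪ D, g * y ∈ C ∪ D := fun y hy => (mem_stabilizer_set.1 hg y).2 hy
    have h1 : g⁻¹ * d ∈ C := by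
      rcases hginv d (Or.inr hd) with h | h
      · exact h
      · exfalso
        have h2 := mem_leftCoset.1 (hDc h)
        have h3 := mem_leftCoset.1 (hDc hd)
        have h4 := mul_mem h3 (inv_mem h2)
        apply hgH
        convert h4 using 1
        rw [mul_left_comm]
        group
    have h2 : d⁻¹ * x ∈ stabilizer G C := by
      have h3 := mem_leftCoset.1 (hDc hd)
      have h4 := mul_mem (inv_mem h3) (mem_leftCoset.1 hx)
      convert h4 using 1
      group
    have h3 : g⁻¹ * x ∈ C := by
      have h4 := (mem_stabilizer_set.1 h2 _).2 h1
      convert h4 using 1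
      simp [mul_comm, mul_left_comm]
    rcases hmem _ (Or.inl h3) with h | h
    · exact hdisj x hx (by simpa using h)
    · exact hxD (by simpa using h)
  refine stabilizer_union_eq_right ?_ hle hsub
  rw [Set.disjoint_left]
  exact fun y hy hyD => hdisj y (hDc hyD) hy

theorem stabilizer_smul_set (g : G) (A : Set G) : stabilizer G (g • A) = stabilizer G A := by
  ext x
  rw [mem_stabilizer_iff, mem_stabilizer_iff, smul_comm]
  exact smul_left_cancel_iff g

variable [Finite G]

theorem ncard_le_ncard_mul {A B : Set G} (hB : B.Nonempty) : A.ncard ≤ (A * B).ncard := by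
  obtain ⟨b, hb⟩ := hB
  rw [← Set.ncard_smul_set b A]
  refine Set.ncard_le_ncard ?_
  rintro _ ⟨a, ha, rfl⟩
  exact ⟨a, ha, b, hb, mul_comm _ _⟩

/-- Replacing a part of `X` in a coset of `H` by the whole coset. -/
theorem ncard_mul_add_card_le (X : Set G) {L H : Subgroup G} (hLH : L ≤ H) {c : G}
    (hX : (X ∩ c • (H : Set G)).Nonempty) :
    (X * (L : Set G)).ncard + Nat.card H ≤
      (X * (H : Set G)).ncard + ((X ∩ c • (H : Set G)) * (L : Set G)).ncard := by
  have h1 : X * (L : Set G) ⊆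
      ((X ∩ c • (H : Set G)) * (L : Set G)) ∪ ((X \ c • (H : Set G)) * (L : Set G)) := by
    rw [← Set.union_mul, Set.inter_union_sdiff]
  have h2 : ((X \ c • (H : Set G)) * (L : Set G)) ∪ c • (H : Set G) ⊆ X * (H : Set G) := by
    refine Set.union_subset (Set.mul_subset_mul Set.sdiff_subset hLH) ?_
    intro y hy
    obtain ⟨x, hx, hxc⟩ := hX
    refine mem_mul_subgroup.2 ⟨x, hx, ?_⟩
    have h4 := mul_mem (inv_mem (mem_leftCoset.1 hxc)) (mem_leftCoset.1 hy)
    convert h4 using 1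
    group
  have h3 : Disjoint ((X \ c • (H : Set G)) * (L : Set G)) (c • (H : Set G)) := by
    rw [Set.disjoint_left]
    intro y hy hyc
    obtain ⟨x, ⟨hx, hxc⟩, h⟩ := mem_mul_subgroup.1 hy
    apply hxc
    rw [mem_leftCoset] at hyc ⊢
    have h4 := mul_mem hyc (inv_mem (hLH h))
    convert h4 using 1
    group
  have h4 := (Set.ncard_le_ncard h1).trans (Set.ncard_union_le _ _)
  have h5 := Set.ncard_le_ncard h2
  rw [Set.ncard_union_eq h3, ncard_leftCoset] at h5
  omega

/-- The inequality of Kneser's theorem. -/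
def Holds (A B : Set G) : Prop :=
  (A * (stabilizer G (A * B) : Set G)).ncard + (B * (stabilizer G (A * B) : Set G)).ncard ≤
    (A * B).ncard + Nat.card (stabilizer G (A * B))

/-- `C` is convergent with respect to `A` and `B`. -/
def Convergent (A B C : Set G) : Prop :=
  C ⊆ A * B ∧ C.Nonempty ∧
    (A ∩ B).ncard + ((A ∪ B) * (stabilizer G C : Set G)).ncard ≤
      C.ncard + Nat.card (stabilizer G C)

theorem card_lt_card_of_lt {L H : Subgroup G} (h : L < H) : Nat.card L < Nat.card H := by
  rw [← ncard_subgroup, ← ncard_subgroup]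
  exact Set.ncard_lt_ncard h

/-- If the stabilizer `H` of a convergent set is minimal, then adding the product of
two parts of `A` and `B` in cosets of `H` does not give a convergent set. -/
theorem not_convergent_union {A B C : Set G} (hC : Convergent A B C)
    (hmin : ∀ C', Convergent A B C' → Nat.card (stabilizer G C) ≤ Nat.card (stabilizer G C'))
    {a b : G} (hab : ¬ (a * b) • (stabilizer G C : Set G) ⊆ A * B) {D : Set G}
    (hD : D = (A ∩ a • (stabilizer G C : Set G)) * (B ∩ b • (stabilizer G C : Set G)))
    (hDne : D.Nonempty) :
    stabilizer G D ≤ stabilizer G C ∧ D ⊆ (a * b) • (stabilizer G C : Set G) ∧ Disjoint C D ∧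
    ((A ∪ B) * (stabilizer G C : Set G)).ncard + D.ncard + Nat.card (stabilizer G D) <
      ((A ∪ B) * (stabilizer G D : Set G)).ncard + Nat.card (stabilizer G C) ∧
    D.ncard + 2 * Nat.card (stabilizer G D) ≤ Nat.card (stabilizer G C) := by
  obtain ⟨hCAB, hCne, hCc⟩ := hC
  have hDAB : D ⊆ A * B := hD ▸ Set.mul_subset_mul Set.inter_subset_left Set.inter_subset_left
  have hDc : D ⊆ (a * b) • (stabilizer G C : Set G) := by
    rw [hD]
    rintro _ ⟨x, ⟨-, hx⟩, y, ⟨-, hy⟩, rfl⟩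
    rw [mem_leftCoset] at hx hy ⊢
    convert mul_mem hx hy using 1
    rw [mul_inv, mul_mul_mul_comm]
  obtain ⟨x, hx, hxAB⟩ := Set.not_subset.1 hab
  have habC : ∀ y ∈ (a * b) • (stabilizer G C : Set G), y ∉ C := by
    intro y hy hyC
    apply hxAB (hCAB _)
    have h1 := mul_mem (inv_mem (mem_leftCoset.1 hy)) (mem_leftCoset.1 hx)
    have h2 := (mem_stabilizer_set.1 h1 y).2 hyC
    convert h2 using 1
    simp only [smul_eq_mul]
    rw [mul_comm]
    group
  have hle := stabilizer_le_of_subset_leftCoset hDne hDc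
  have hst : stabilizer G (C ∪ D) = stabilizer G D :=
    stabilizer_union_of_ssubset_leftCoset hDne hDc hx (fun h => hxAB (hDAB h))
      (habC _ (mem_leftCoset.2 (by simp)))
  have hdisj : Disjoint C D := Set.disjoint_left.2 fun y hy hyD => habC y (hDc hyD) hy
  have hlt : stabilizer G D < stabilizer G C := by
    refine lt_of_le_of_ne hle fun h => hab ?_
    obtain ⟨d, hd⟩ := hDne
    intro y hy
    apply hDAB
    have h1 := mul_mem (inv_mem (mem_leftCoset.1 (hDc hd))) (mem_leftCoset.1 hy)
    rw [← h] at h1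
    have h2 := (mem_stabilizer_set.1 h1 d).2 hd
    convert h2 using 1
    simp only [smul_eq_mul]
    rw [mul_comm]
    group
  -- Otherwise `C ∪ D` would be convergent, with a strictly smaller stabilizer than `C`.
  have hkey : ((A ∪ B) * (stabilizer G C : Set G)).ncard + D.ncard + Nat.card (stabilizer G D) <
      ((A ∪ B) * (stabilizer G D : Set G)).ncard + Nat.card (stabilizer G C) := by
    by_contra hcon
    have hconv : Convergent A B (C ∪ D) := by
      refine ⟨Set.union_subset hCAB hDAB, hCne.mono Set.subset_union_left, ?_⟩
      rw [hst, Set.ncard_union_eq hdisj]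
      omega
    have h1 := hmin _ hconv
    rw [hst] at h1
    exact absurd (card_lt_card_of_lt hlt) (not_lt.2 h1)
  refine ⟨hle, hDc, hdisj, hkey, ?_⟩
  have h1 : ((A ∪ B) * (stabilizer G D : Set G)).ncard ≤
      ((A ∪ B) * (stabilizer G C : Set G)).ncard :=
    Set.ncard_le_ncard (Set.mul_subset_mul_left hle)
  -- `|D|` and `|stabilizer C|` are multiples of `|stabilizer D|`, so the strict inequality `h2`
  -- improves by a whole `|stabilizer D|`.
  obtain ⟨u, hu⟩ := Subgroup.card_dvd_of_le hle
  obtain ⟨v, hv⟩ := card_dvd_ncard_mul D (stabilizer G D)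
  rw [mul_stabilizer_self] at hv
  have h2 : D.ncard + Nat.card (stabilizer G D) < Nat.card (stabilizer G C) := by omega
  rw [hu, hv] at h2 ⊢
  have h3 : v + 1 < u := by
    by_contra h
    have := Nat.mul_le_mul_left (Nat.card (stabilizer G D)) (not_lt.1 h)
    rw [mul_add] at this
    omega
  have := Nat.mul_le_mul_left (Nat.card (stabilizer G D)) (Nat.succ_le_of_lt h3)
  simp only [Nat.succ_eq_add_one, mul_add] at this
  omega

/-- Replacing two parts of `X` in distinct cosets of `H` by the whole cosets. -/
theorem ncard_add_two_mul_card_le (X : Set G) {H : Subgroup G} {a b : G}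
    (ha : (X ∩ a • (H : Set G)).Nonempty) (hb : (X ∩ b • (H : Set G)).Nonempty)
    (hab : a⁻¹ * b ∉ H) :
    X.ncard + 2 * Nat.card H ≤ (X * (H : Set G)).ncard +
      (X ∩ a • (H : Set G)).ncard + (X ∩ b • (H : Set G)).ncard := by
  have hdisj : Disjoint (a • (H : Set G)) (b • (H : Set G)) := by
    rw [Set.disjoint_left]
    intro y hya hyb
    apply hab
    convert mul_mem (mem_leftCoset.1 hya) (inv_mem (mem_leftCoset.1 hyb)) using 1
    group
  have hsub : ∀ c : G, (X ∩ c • (H : Set G)).Nonempty → c • (H : Set G) ⊆ X * (H : Set G) := by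
    rintro c ⟨x, hx, hxc⟩ y hy
    refine mem_mul_subgroup.2 ⟨x, hx, ?_⟩
    convert mul_mem (inv_mem (mem_leftCoset.1 hxc)) (mem_leftCoset.1 hy) using 1
    group
  have h1 := Set.ncard_le_ncard (Set.union_subset
    ((Set.sdiff_subset (s := X) (t := a • (H : Set G) ∪ b • (H : Set G))).trans
      (subset_mul_subgroup X H)) (Set.union_subset (hsub a ha) (hsub b hb)))
  rw [Set.ncard_union_eq Set.disjoint_sdiff_left, Set.ncard_union_eq hdisj, ncard_leftCoset,
    ncard_leftCoset] at h1
  have h2 : X.ncard ≤ ((X ∩ a • (H : Set G)) ∪ (X ∩ b • (H : Set G)) ∪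
      (X \ (a • (H : Set G) ∪ b • (H : Set G)))).ncard := by
    refine Set.ncard_le_ncard ?_
    intro x hx
    by_cases h : x ∈ a • (H : Set G) ∪ b • (H : Set G)
    · rcases h with h | h
      · exact Or.inl (Or.inl ⟨hx, h⟩)
      · exact Or.inl (Or.inr ⟨hx, h⟩)
    · exact Or.inr ⟨hx, h⟩
  have h3 := Set.ncard_union_le ((X ∩ a • (H : Set G)) ∪ (X ∩ b • (H : Set G)))
    (X \ (a • (H : Set G) ∪ b • (H : Set G)))
  have h4 := Set.ncard_union_le (X ∩ a • (H : Set G)) (X ∩ b • (H : Set G))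
  omega

theorem exists_not_subset_of_card_lt {A B : Set G} {H : Subgroup G}
    (h : Nat.card (stabilizer G (A * B)) < Nat.card H) :
    ∃ a ∈ A, ∃ b ∈ B, ¬ (a * b) • (H : Set G) ⊆ A * B := by
  by_contra! hcon
  apply absurd h
  rw [not_lt]
  have hle : H ≤ stabilizer G (A * B) := by
    intro g hg
    rw [mem_stabilizer_set' (Set.toFinite _)]
    rintro _ ⟨a, ha, b, hb, rfl⟩
    apply hcon a ha b hb
    rw [mem_leftCoset]
    convert hg using 1
    simp only [smul_eq_mul]
    rw [mul_comm g]
    group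
  exact Nat.card_le_card_of_injective _ (Subgroup.inclusion_injective hle)

/-- If a convergent `C` with minimal stabilizer `H` is not enough by itself, some `(a * b) • H` is
not contained in `A * B`. Neither `C ∪ (A ∩ aH)(B ∩ bH)` nor `C ∪ (A ∩ bH)(B ∩ aH)` can then be
convergent. The two failures, combined with Kneser's inequality for these smaller products, give the
bound. -/
theorem ncard_add_ncard_le_of_convergent {A B : Set G}
    (hP : ∀ A' B' : Set G, A'.Nonempty → B'.Nonempty → (A' * B').ncard < (A * B).ncard →
      Holds A' B')
    (hconv : ∃ C, Convergent A B C) :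
    A.ncard + B.ncard ≤ (A * B).ncard + Nat.card (stabilizer G (A * B)) := by
  by_contra! hcon
  obtain ⟨C, hC, hmin⟩ := Set.exists_min_image {C | Convergent A B C}
    (fun C => Nat.card (stabilizer G C)) (Set.toFinite _) hconv
  have hunion := Set.ncard_union_add_ncard_inter A B
  have hX := Set.ncard_le_ncard (subset_mul_subgroup (A ∪ B) (stabilizer G C))
  have hCAB := Set.ncard_le_ncard hC.1
  have hCc := hC.2.2
  obtain hle | hlt := le_or_gt (Nat.card (stabilizer G C)) (Nat.card (stabilizer G (A * B)))
  · omega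
  obtain ⟨a, ha, b, hb, hab⟩ := exists_not_subset_of_card_lt hlt
  have hCpos : 0 < C.ncard := hC.2.1.ncard_pos
  have small : ∀ x y : G, Disjoint C ((A ∩ x • (stabilizer G C : Set G)) *
      (B ∩ y • (stabilizer G C : Set G))) →
      ((A ∩ x • (stabilizer G C : Set G)) * (B ∩ y • (stabilizer G C : Set G))).ncard <
        (A * B).ncard := by
    intro x y hd
    have h1 := Set.ncard_le_ncard (Set.union_subset hC.1
      (Set.mul_subset_mul Set.inter_subset_left Set.inter_subset_left :
        (A ∩ x • (stabilizer G C : Set G)) * (B ∩ y • (stabilizer G C : Set G)) ⊆ A * B))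
    rw [Set.ncard_union_eq hd] at h1
    omega
  have hself : ∀ x : G, x ∈ x • (stabilizer G C : Set G) := fun x => mem_leftCoset.2 (by simp)
  have hA1 : (A ∩ a • (stabilizer G C : Set G)).Nonempty := ⟨a, ha, hself a⟩
  have hB1 : (B ∩ b • (stabilizer G C : Set G)).Nonempty := ⟨b, hb, hself b⟩
  obtain ⟨hle1, hDc1, hd1, hk1, hh1⟩ :=
    not_convergent_union hC (fun C' h => hmin C' h) hab rfl (hA1.mul hB1)
  have P1 := hP _ _ hA1 hB1 (small a b hd1)
  unfold Holds at P1
  set A1 := A ∩ a • (stabilizer G C : Set G) with hA1def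
  set B1 := B ∩ b • (stabilizer G C : Set G) with hB1def
  set A2 := A ∩ b • (stabilizer G C : Set G) with hA2def
  set B2 := B ∩ a • (stabilizer G C : Set G) with hB2def
  have hXa : (A ∪ B) ∩ a • (stabilizer G C : Set G) = A1 ∪ B2 := Set.union_inter_distrib_right ..
  have hXb : (A ∪ B) ∩ b • (stabilizer G C : Set G) = A2 ∪ B1 := Set.union_inter_distrib_right ..
  have ca := ncard_mul_add_card_le (A ∪ B) hle1 (c := a) (by rw [hXa]; exact hA1.inl)
  have cb := ncard_mul_add_card_le (A ∪ B) hle1 (c := b) (by rw [hXb]; exact hB1.inr)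
  rw [hXa, Set.union_mul (s₁ := A1)] at ca
  rw [hXb, Set.union_mul (s₁ := A2)] at cb
  have ca' := ca.trans (Nat.add_le_add_left (Set.ncard_union_le _ _) _)
  have cb' := cb.trans (Nat.add_le_add_left (Set.ncard_union_le _ _) _)
  -- With `K₁` the stabilizer of `A1 * B1`, the bounds `P1`, `hk1`, `ca'` and `cb'` give `|B1 K₁| <
  -- |B2 K₁|` and `|A1 K₁| < |A2 K₁|`. Hence `A2` and `B2` are nonempty, and the cosets of `a` and
  -- `b` differ.
  have hA2 : A2.Nonempty := by
    rw [Set.nonempty_iff_ne_empty]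
    intro h
    rw [h, Set.empty_mul, Set.ncard_empty] at cb'
    omega
  have hB2 : B2.Nonempty := by
    rw [Set.nonempty_iff_ne_empty]
    intro h
    rw [h, Set.empty_mul (s := (stabilizer G (A1 * B1) : Set G)), Set.ncard_empty] at ca'
    omega
  have hne : a⁻¹ * b ∉ stabilizer G C := by
    intro h
    have hcos : a • (stabilizer G C : Set G) = b • (stabilizer G C : Set G) :=
      (leftCoset_eq_iff _).2 h
    have hAA : A2 = A1 := by rw [hA2def, hA1def, hcos]
    rw [hAA] at cb'
    omega
  obtain ⟨hle2, hDc2, hd2, hk2, hh2⟩ :=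
    not_convergent_union hC (fun C' h => hmin C' h) (a := b) (b := a) (D := A2 * B2)
      (by rwa [mul_comm]) rfl
      (hA2.mul hB2)
  have P2 := hP _ _ hA2 hB2 (small b a hd2)
  unfold Holds at P2
  have c0 := ncard_add_two_mul_card_le (A ∪ B) (H := stabilizer G C) (a := a) (b := b)
    (by rw [hXa]; exact hA1.inl) (by rw [hXb]; exact hB1.inr) hne
  rw [hXa, hXb] at c0
  have i1 := Set.ncard_union_le A1 B2
  have i2 := Set.ncard_union_le A2 B1
  have j1 := Set.ncard_le_ncard (subset_mul_subgroup A1 (stabilizer G (A1 * B1)))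
  have j2 := Set.ncard_le_ncard (subset_mul_subgroup B1 (stabilizer G (A1 * B1)))
  have j3 := Set.ncard_le_ncard (subset_mul_subgroup A2 (stabilizer G (A2 * B2)))
  have j4 := Set.ncard_le_ncard (subset_mul_subgroup B2 (stabilizer G (A2 * B2)))
  have hD : C.ncard + (A1 * B1 ∪ A2 * B2).ncard ≤ (A * B).ncard := by
    rw [← Set.ncard_union_eq (Set.disjoint_union_right.2 ⟨hd1, hd2⟩)]
    refine Set.ncard_le_ncard (Set.union_subset hC.1 (Set.union_subset ?_ ?_)) <;>
      exact Set.mul_subset_mul Set.inter_subset_left Set.inter_subset_left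
  have hDD := Set.ncard_union_add_ncard_inter (A1 * B1) (A2 * B2)
  have k1 := Set.ncard_le_ncard (Set.inter_subset_left (s := A1 * B1) (t := A2 * B2))
  have k2 := Set.ncard_le_ncard (Set.inter_subset_right (s := A1 * B1) (t := A2 * B2))
  -- By `c0`, convergence, `P1` and `P2`, `|A| + |B| + |H| ≤ |C| + |D₁| + |D₂| + |K₁| + |K₂|`, where
  -- `Dᵢ = Aᵢ * Bᵢ` has stabilizer `Kᵢ`. Here `|D₁| + |D₂|` is `|D₁ ∪ D₂| + |D₁ ∩ D₂|`, and
  -- averaging `hh1` and `hh2` gives `|D₁ ∩ D₂| + |K₁| + |K₂| ≤ |H|`.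
  omega

/-- Supplies the convergent set: after a translation of `B`, it is `(A ∩ B) * (A ∪ B)`. Periodicity
of `A` and `B` passes to `A ∩ B` and `A ∪ B`, so the induction on `|A|` survives when this product
is all of `A * B`. -/
theorem ncard_add_ncard_le_of_periodic {n : ℕ}
    (hP : ∀ A B : Set G, A.Nonempty → B.Nonempty → (A * B).ncard < n → Holds A B) (m : ℕ) :
    ∀ A B : Set G, A.Nonempty → B.Nonempty → (A * B).ncard = n → A.ncard = m →
      A * (stabilizer G (A * B) : Set G) = A → B * (stabilizer G (A * B) : Set G) = B →
      A.ncard + B.ncard ≤ (A * B).ncard + Nat.card (stabilizer G (A * B)) := by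
  induction m using Nat.strong_induction_on with
  | _ m ih =>
    have main : ∀ A B : Set G, (A ∩ B).Nonempty → ¬ A ⊆ B → (A * B).ncard = n → A.ncard = m →
        A * (stabilizer G (A * B) : Set G) = A → B * (stabilizer G (A * B) : Set G) = B →
        A.ncard + B.ncard ≤ (A * B).ncard + Nat.card (stabilizer G (A * B)) := by
      intro A B hAB hne hn hm hA hB
      have hsub : (A ∩ B) * (A ∪ B) ⊆ A * B := by
        rintro _ ⟨x, ⟨hxA, hxB⟩, y, hy | hy, rfl⟩
        · exact ⟨y, hy, x, hxB, mul_comm _ _⟩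
        · exact ⟨x, hxA, y, hy, rfl⟩
      have hU : (A ∪ B).Nonempty := hAB.mono (Set.inter_subset_left.trans Set.subset_union_left)
      refine ncard_add_ncard_le_of_convergent (hn ▸ hP)
        ⟨(A ∩ B) * (A ∪ B), hsub, hAB.mul hU, ?_⟩
      obtain hlt | hge := lt_or_ge (((A ∩ B) * (A ∪ B)).ncard) (A * B).ncard
      · have h1 := hP _ _ hAB hU (hn ▸ hlt)
        have h2 := Set.ncard_le_ncard
          (subset_mul_subgroup (A ∩ B) (stabilizer G ((A ∩ B) * (A ∪ B))))
        unfold Holds at h1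
        omega
      · have heq := Set.eq_of_subset_of_ncard_le hsub hge
        have hlt : (A ∩ B).ncard < m := by
          rw [← hm]
          refine Set.ncard_lt_ncard ⟨Set.inter_subset_left, fun h => hne fun x hx => (h hx).2⟩
        have hU' : (A ∪ B) * (stabilizer G (A * B) : Set G) = A ∪ B := by
          rw [Set.union_mul, hA, hB]
        have hI : (A ∩ B) * (stabilizer G (A * B) : Set G) = A ∩ B := by
          refine (Set.inter_mul_subset.trans ?_).antisymm (subset_mul_subgroup _ _)
          rw [hA, hB]
        have h1 := ih _ hlt (A ∩ B) (A ∪ B) hAB hU (by rw [heq, hn]) rfl (by rw [heq, hI])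
          (by rw [heq, hU'])
        rw [heq, hU']
        rwa [heq] at h1
    intro A B hAne hBne hn hm hA hB
    -- If no translation makes `A` meet `B` without lying in it, then `a⁻¹ • A` stabilizes `B`. So
    -- `|A|` is at most the order of the stabilizer, while `|B| ≤ |A * B|`.
    by_cases hcase : ∀ a ∈ A, ∀ b ∈ B, A ⊆ (a * b⁻¹) • B
    · obtain ⟨a, ha⟩ := hAne
      have hsub : A ⊆ a • (stabilizer G (A * B) : Set G) := by
        intro x hx
        rw [mem_leftCoset]
        refine (mul_comm A B ▸ stabilizer_le_mul_right B A : stabilizer G B ≤ _) ?_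
        rw [mem_stabilizer_set' (Set.toFinite _)]
        intro b hb
        have h1 := hcase a ha b hb hx
        rw [Set.mem_smul_set_iff_inv_smul_mem] at h1
        convert h1 using 1
        simp only [smul_eq_mul, mul_inv, inv_inv]
        rw [mul_right_comm]
      have h1 := Set.ncard_le_ncard hsub
      rw [ncard_leftCoset] at h1
      have h2 := ncard_le_ncard_mul (A := B) ⟨a, ha⟩
      rw [mul_comm B A] at h2
      omega
    · push Not at hcase
      obtain ⟨a, ha, b, hb, hnot⟩ := hcase
      have hmul : A * (a * b⁻¹) • B = (a * b⁻¹) • (A * B) := mul_smul_comm _ _ _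
      have h1 := main A ((a * b⁻¹) • B)
        ⟨a, ha, Set.mem_smul_set.2 ⟨b, hb, by simp⟩⟩ hnot
        (by rw [hmul, Set.ncard_smul_set, hn]) hm
        (by rw [hmul, stabilizer_smul_set, hA])
        (by rw [hmul, stabilizer_smul_set, smul_mul_assoc, hB])
      rwa [hmul, stabilizer_smul_set, Set.ncard_smul_set, Set.ncard_smul_set] at h1

/-- **Kneser's theorem** for finite commutative groups. -/
theorem ncard_mul_add_ncard_mul_le {A B : Set G} (hA : A.Nonempty) (hB : B.Nonempty) :
    (A * (stabilizer G (A * B) : Set G)).ncard + (B * (stabilizer G (A * B) : Set G)).ncard ≤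
      (A * B).ncard + Nat.card (stabilizer G (A * B)) := by
  suffices h : ∀ n, ∀ A B : Set G, A.Nonempty → B.Nonempty → (A * B).ncard = n → Holds A B from
    h _ A B hA hB rfl
  intro n
  induction n using Nat.strong_induction_on with
  | _ n ih =>
    intro A B hA hB hn
    have hmul : A * (stabilizer G (A * B) : Set G) * (B * (stabilizer G (A * B) : Set G)) =
        A * B := by
      rw [mul_mul_mul_comm, coe_mul_coe, mul_stabilizer_self]
    have hK : (stabilizer G (A * B) : Set G).Nonempty := ⟨1, one_mem _⟩
    have h1 := ncard_add_ncard_le_of_periodic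
      (fun A' B' hA' hB' hlt => ih _ hlt A' B' hA' hB' rfl) _
      (A * (stabilizer G (A * B) : Set G)) (B * (stabilizer G (A * B) : Set G))
      (hA.mul hK) (hB.mul hK) (by rw [hmul, hn]) rfl
      (by rw [hmul, mul_assoc, coe_mul_coe]) (by rw [hmul, mul_assoc, coe_mul_coe])
    rwa [hmul] at h1

/-- Kneser's theorem for products of several sets. -/
theorem sum_ncard_mul_le {ι : Type*} [Fintype ι] {A : ι → Set G} (hA : ∀ i, (A i).Nonempty) :
    ∑ i, (A i * (stabilizer G (∏ i, A i) : Set G)).ncard +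
        Nat.card (stabilizer G (∏ i, A i)) ≤
      (∏ i, A i).ncard + Fintype.card ι * Nat.card (stabilizer G (∏ i, A i)) := by
  classical
  set H := stabilizer G (∏ i, A i) with hH
  have hHne : (H : Set G).Nonempty := ⟨1, one_mem _⟩
  have key : ∀ s : Finset ι, ∑ i ∈ s, (A i * (H : Set G)).ncard + Nat.card H ≤
      ((∏ i ∈ s, A i) * (H : Set G)).ncard + s.card * Nat.card H := by
    intro s
    induction s using Finset.induction_on with
    | empty => simp [ncard_subgroup]
    | insert i s hi ih =>
      rw [Finset.sum_insert hi, Finset.prod_insert hi, Finset.card_insert_of_notMem hi]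
      have hmul : A i * ((∏ j ∈ s, A j) * (H : Set G)) = A i * (∏ j ∈ s, A j) * (H : Set G) :=
        (mul_assoc _ _ _).symm
      -- Multiplying by the remaining factors gives the full product, so the stabilizer is at most
      -- `H`; the factor `H` gives the other inclusion. The same `H` therefore serves at every
      -- stage.
      have hst : stabilizer G (A i * ((∏ j ∈ s, A j) * (H : Set G))) = H := by
        refine le_antisymm ?_ ?_
        · have h1 := stabilizer_le_mul_right (A i * ((∏ j ∈ s, A j) * (H : Set G)))
            (∏ j ∈ (insert i s)ᶜ, A j)
          have h2 : A i * ((∏ j ∈ s, A j) * (H : Set G)) * (∏ j ∈ (insert i s)ᶜ, A j) =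
              ∏ j, A j := by
            rw [hmul, ← Finset.prod_insert hi, mul_right_comm, Finset.prod_mul_prod_compl,
              hH, mul_stabilizer_self]
          rwa [h2, ← hH] at h1
        · have h1 := stabilizer_le_mul_right (H : Set G) (A i * (∏ j ∈ s, A j))
          rwa [stabilizer_subgroup, mul_comm (H : Set G), ← hmul] at h1
      have hprod : Set.Nonempty (∏ j ∈ s, A j) :=
        ⟨_, Set.finsetProd_mem_finsetProd s A (fun j => (hA j).some) fun j _ => (hA j).some_mem⟩
      have h1 := ncard_mul_add_ncard_mul_le (hA i)
        (hprod.mul hHne)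
      rw [hst, hmul, mul_assoc (∏ j ∈ s, A j), coe_mul_coe] at h1
      rw [add_mul, one_mul]
      omega
  have h1 := key Finset.univ
  rwa [hH, mul_stabilizer_self, ← hH] at h1

end Kneser

/-! ### Families of units whose transversal products avoid 1 -/

/-- For each `i` there are `d i` distinct units such that no transversal has product `1`. -/
def HasTransversalFreeFamily (F : Type*) [Field F] {ω : ℕ} (d : Fin ω → ℕ) : Prop :=
  ∃ r : ∀ i, Fin (d i) → Fˣ, (∀ i, Function.Injective (r i)) ∧
    ∀ j : ∀ i, Fin (d i), ∏ i, r i (j i) ≠ 1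

namespace HasTransversalFreeFamily

theorem map {F F' : Type*} [Field F] [Field F'] (φ : F →+* F') {ω : ℕ} {d : Fin ω → ℕ}
    (h : HasTransversalFreeFamily F d) : HasTransversalFreeFamily F' d := by
  obtain ⟨r, hr, hprod⟩ := h
  have hinj : Function.Injective (Units.map (φ : F →* F')) := Units.map_injective φ.injective
  refine ⟨fun i j => Units.map (φ : F →* F') (r i j), fun i => hinj.comp (hr i), fun j h => ?_⟩
  rw [← map_prod, ← map_one (Units.map (φ : F →* F'))] at h
  exact hprod j (hinj h)

/-- A product of elements of `G` with exactly one element outside `G` lies outside `G`. -/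
theorem of_subgroup {K : Type*} [Field K] [Finite K] (G : Subgroup Kˣ) {ω : ℕ} (hω : 0 < ω) :
    HasTransversalFreeFamily K (criterionTuple ω (Nat.card K) (Nat.card G)) := by
  have h1 : Nat.card {x : Kˣ // x ∉ G} = Nat.card K - Nat.card G - 1 := by
    have h2 := Set.ncard_add_ncard_compl (G : Set Kˣ)
    have h3 : (G : Set Kˣ).ncard = Nat.card G := rfl
    have h4 : (G : Set Kˣ)ᶜ.ncard = Nat.card {x : Kˣ // x ∉ G} := rfl
    rw [Nat.card_units] at h2
    omega
  have h : ∀ i : Fin ω, ∃ f : Fin (criterionTuple ω (Nat.card K) (Nat.card G) i) → Kˣ,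
      Function.Injective f ∧ ∀ j, f j ∈ G ↔ (i : ℕ) + 1 ≠ ω := by
    intro i
    by_cases hi : (i : ℕ) + 1 = ω
    · have e : Fin (criterionTuple ω (Nat.card K) (Nat.card G) i) ≃ {x : Kˣ // x ∉ G} :=
        (finCongr (by rw [criterionTuple, if_pos hi, h1])).trans (Finite.equivFin _).symm
      exact ⟨fun j => e j, Subtype.val_injective.comp e.injective, fun j =>
        ⟨fun h => absurd h (e j).2, fun h => absurd hi h⟩⟩
    · have e : Fin (criterionTuple ω (Nat.card K) (Nat.card G) i) ≃ G :=
        (finCongr (by rw [criterionTuple, if_neg hi])).trans (Finite.equivFin _).symm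
      exact ⟨fun j => e j, Subtype.val_injective.comp e.injective, fun j =>
        ⟨fun _ => hi, fun _ => (e j).2⟩⟩
  choose r hr hG using h
  refine ⟨r, hr, fun j hj => ?_⟩
  let l : Fin ω := ⟨ω - 1, by omega⟩
  have hl : (l : ℕ) + 1 = ω := Nat.succ_pred_eq_of_pos hω
  rw [← Finset.mul_prod_erase Finset.univ _ (Finset.mem_univ l)] at hj
  have hmem : ∏ i ∈ Finset.univ.erase l, r i (j i) ∈ G := by
    refine prod_mem fun i hi => (hG i (j i)).2 fun h => (Finset.ne_of_mem_erase hi) ?_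
    ext
    omega
  have hlG : r l (j l) ∈ G := by
    rw [eq_inv_of_mul_eq_one_left hj]
    exact inv_mem hmem
  exact (hG l _).1 hlG hl

open scoped Pointwise in
open MulAction Kneser in
/-- The consequence of Kneser's theorem for families without transversal of product `1`. -/
theorem exists_subgroup {F : Type*} [Field F] [Finite F] {ω : ℕ} {d : Fin ω → ℕ}
    (hd : ∀ i, 0 < d i) (h : HasTransversalFreeFamily F d) :
    ∃ (H : Subgroup Fˣ) (c : Fin ω → ℕ) (m : ℕ), (∀ i, d i ≤ Nat.card H * c i) ∧
      Nat.card Fˣ = Nat.card H * m ∧ ∑ i, c i + 2 ≤ m + ω := by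
  obtain ⟨r, hr, hprod⟩ := h
  have hne : ∀ i, (Set.range (r i)).Nonempty := fun i => ⟨_, ⟨⟨0, hd i⟩, rfl⟩⟩
  have hK := sum_ncard_mul_le hne
  have h1 : (1 : Fˣ) ∉ ∏ i, Set.range (r i) := by
    rw [Set.mem_fintype_prod]
    rintro ⟨g, hg, h1⟩
    choose j hj using hg
    exact hprod j (by simp only [hj, h1])
  set B := ∏ i, Set.range (r i)
  set H := stabilizer Fˣ B
  have hc : ∀ i, ∃ c, (Set.range (r i) * (H : Set Fˣ)).ncard = Nat.card H * c :=
    fun i => card_dvd_ncard_mul _ _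
  choose c hc using hc
  obtain ⟨m, hm⟩ := Subgroup.card_subgroup_dvd_card H
  refine ⟨H, c, m, fun i => ?_, hm, ?_⟩
  · rw [← hc i]
    have h2 := Set.ncard_le_ncard (subset_mul_subgroup (Set.range (r i)) H)
    have h3 : (Set.range (r i)).ncard = d i := by
      rw [← Set.image_univ, Set.ncard_image_of_injective _ (hr i), Set.ncard_univ, Nat.card_fin]
    omega
  -- A point of `B` in `H` could be moved to `1` by an element of the stabilizer.
  · have hdisj : Disjoint B (H : Set Fˣ) := by
      rw [Set.disjoint_left]
      intro x hx hxH
      apply h1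
      have := (mem_stabilizer_set.1 (inv_mem hxH) x).2 hx
      simpa using this
    have h2 : B.ncard + Nat.card H ≤ Nat.card Fˣ := by
      rw [← ncard_subgroup H, ← Set.ncard_union_eq hdisj, ← Set.ncard_univ]
      exact Set.ncard_le_ncard (Set.subset_univ _)
    simp only [hc, ← Finset.mul_sum, Fintype.card_fin] at hK
    have hpos : 0 < Nat.card H := Nat.card_pos
    have h3 : Nat.card H * (∑ i, c i + 2) ≤ Nat.card H * (m + ω) := by
      rw [mul_add, mul_add, ← hm, mul_comm _ ω]
      omega
    exact Nat.le_of_mul_le_mul_left h3 hpos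

theorem sum_ge_of_last {ω x y : ℕ} (hω : 0 < ω) {c : Fin ω → ℕ}
    (hx : ∀ i : Fin ω, (i : ℕ) + 1 ≠ ω → x ≤ c i) (hy : ∀ i : Fin ω, (i : ℕ) + 1 = ω → y ≤ c i) :
    (ω - 1) * x + y ≤ ∑ i, c i := by
  let l : Fin ω := ⟨ω - 1, by omega⟩
  have hl : (l : ℕ) + 1 = ω := Nat.succ_pred_eq_of_pos hω
  rw [← Finset.sum_erase_add Finset.univ _ (Finset.mem_univ l)]
  refine add_le_add ?_ (hy l hl)
  have h := Finset.card_nsmul_le_sum (Finset.univ.erase l) c x fun i hi => hx i fun h =>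
    (Finset.ne_of_mem_erase hi) (by ext; omega)
  simpa using h

/-- The numerical condition of the theorem, without division. -/
theorem not_of_bound {F : Type*} [Field F] [Finite F] {ω q d : ℕ} (hω : 0 < ω) (hd : 0 < d)
    (hdq : d + 1 < q)
    (hG : ∀ H : Subgroup Fˣ, H ≠ ⊤ → d > Nat.card H ∨ q + Nat.card H > Nat.card F + d)
    (hbound : ∀ h m x y : ℕ, 1 ≤ h → h < d → Nat.card F - 1 = h * m →
      (∀ z, x ≤ z ↔ d ≤ h * z) → (∀ z, y ≤ z ↔ q - d - 1 ≤ h * z) →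
      m ≤ (ω - 1) * (x - 1) + y) :
    ¬ HasTransversalFreeFamily F (criterionTuple ω q d) := by
  intro hfam
  obtain ⟨H, c, m, hc, hm, hsum⟩ := exists_subgroup (fun i => by
    unfold criterionTuple; split_ifs <;> omega) hfam
  have hpos : 0 < Nat.card H := Nat.card_pos
  -- The ceilings `x = ⌈d / |H|⌉` and `y = ⌈(q - d - 1) / |H|⌉` enter only through this
  -- characterization.
  have hceil : ∀ n : ℕ, ∃ x, ∀ z, x ≤ z ↔ n ≤ Nat.card H * z := fun n =>
    ⟨n ⌈/⌉ Nat.card H, fun z => by rw [ceilDiv_le_iff_le_mul hpos, mul_comm]⟩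
  obtain ⟨x, hx⟩ := hceil d
  obtain ⟨y, hy⟩ := hceil (q - d - 1)
  have hle := sum_ge_of_last hω (c := c) (x := x) (y := y)
    (fun i hi => (hx _).2 (by simpa [criterionTuple, hi] using hc i))
    (fun i hi => (hy _).2 (by simpa [criterionTuple, hi] using hc i))
  have hx1 : 1 ≤ x := by
    by_contra h
    have := (hx 0).1 (by omega)
    omega
  have hy1 : 1 ≤ y := by
    by_contra h
    have := (hy 0).1 (by omega)
    omega
  obtain ⟨x', rfl⟩ := Nat.exists_eq_add_of_le' hx1
  obtain ⟨w, rfl⟩ := Nat.exists_eq_add_of_le' hω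
  simp only [Nat.add_sub_cancel, mul_add, mul_one] at hle hbound
  have hcard : Nat.card F - 1 = Nat.card H * m := by rw [← hm, Nat.card_units]
  have hF : 1 < Nat.card F := Finite.one_lt_card
  obtain hlt | hge := lt_or_ge (Nat.card H) d
  · have := hbound _ m (x' + 1) y hpos hlt hcard hx hy
    simp only [Nat.add_sub_cancel] at this
    omega
  -- Here only `x ≥ 1` is used. Multiplied by `|H|`, the inequality reads `q - d - 1 + |H| ≤ |F| -
  -- 1`, which excludes `H = ⊤` and contradicts `hG`.
  · have hym : y + 1 ≤ m := by omega
    have h1 := Nat.mul_le_mul_left (Nat.card H) hym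
    have h2 := (hy y).1 le_rfl
    rw [mul_add, mul_one, ← hcard] at h1
    have htop : H ≠ ⊤ := by
      rintro rfl
      have h3 : Nat.card (⊤ : Subgroup Fˣ) = Nat.card F - 1 := by
        rw [Subgroup.card_top, Nat.card_units]
      omega
    rcases hG H htop with h | h <;> omega

end HasTransversalFreeFamily

/-! ### Cyclic indices, and transversals as systems of linear equations -/

theorem finRotate_induction {ω : ℕ} {p : Fin ω → Prop}
    (hstep : ∀ k, p k → p ((finRotate ω).symm k)) {k : Fin ω} (hk : p k) (l : Fin ω) : p l := by
  match ω with
  | 0 => exact l.elim0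
  | 1 => rwa [Subsingleton.elim l k]
  | n + 2 =>
    have hmem : ∀ x : Fin (n + 2), finRotate (n + 2) x ≠ x := fun x => by
      have := Equiv.Perm.mem_support.1 (support_finRotate (n := n) ▸ Finset.mem_univ x)
      exact this
    obtain ⟨i, -, hi⟩ := (isCycle_finRotate.sameCycle (hmem l) (hmem k)).exists_pow_eq'
    clear hmem
    induction i generalizing k with
    | zero => simpa [← hi] using hk
    | succ i ih =>
      refine ih (k := (finRotate (n + 2)).symm k) (hstep k hk) ?_
      rw [← hi, pow_succ', Equiv.Perm.mul_apply, Equiv.symm_apply_apply]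

theorem finRotate_ne {ω : ℕ} (hω : 2 ≤ ω) (k : Fin ω) : finRotate ω k ≠ k := by
  obtain ⟨n, rfl⟩ := Nat.exists_eq_add_of_le' hω
  rw [finRotate_apply, Ne, add_eq_left]
  simp

theorem finRotate_finRotate_ne {ω : ℕ} (hω : 3 ≤ ω) (k : Fin ω) :
    finRotate ω (finRotate ω k) ≠ k := by
  obtain ⟨n, rfl⟩ := Nat.exists_eq_add_of_le' hω
  rw [finRotate_apply, finRotate_apply, add_assoc, Ne, add_eq_left]
  simp only [Fin.ext_iff, Fin.val_add, Fin.val_one, Fin.val_zero]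
  rw [Nat.mod_eq_of_lt (by omega)]
  omega

section Transversal

variable {ω : ℕ} {d : Fin ω → ℕ}

/-- Layer-4 nodes `P m`, pairwise distinct, such that `P m` can be reached through `u m`. -/
def IsTransversal (P : Fin ω → Σ i : Fin ω, Fin (d i)) : Prop :=
  Function.Injective P ∧ ∀ m, (P m).1 = m ∨ (P m).1 = finRotate ω m

namespace IsTransversal

/-- The `ω` vectors given by a transversal have trivial left kernel. -/
theorem eq_zero_of_recurrence {F : Type*} [Field F] {r : ∀ i, Fin (d i) → Fˣ}
    (hr : ∀ i, Function.Injective (r i)) (hprod : ∀ j : ∀ i, Fin (d i), ∏ i, r i (j i) ≠ 1)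
    {P : Fin ω → Σ i : Fin ω, Fin (d i)} (hP : IsTransversal P) {y : Fin ω → F}
    (hy : ∀ m, y (P m).1 = r (P m).1 (P m).2 * y ((finRotate ω).symm (P m).1)) : y = 0 := by
  by_contra hne
  obtain ⟨k, hk⟩ := Function.ne_iff.1 hne
  have hpred : ∀ m, y m ≠ 0 → y ((finRotate ω).symm (P m).1) ≠ 0 := by
    intro m hm
    rcases hP.2 m with h | h
    · intro h0
      have := hy m
      rw [h0, mul_zero, h] at this
      exact hm this
    · rwa [h, Equiv.symm_apply_apply]
  have hself : ∀ m, y m ≠ 0 → y (P m).1 ≠ 0 := by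
    intro m hm
    rw [hy m]
    exact mul_ne_zero (Units.ne_zero _) (hpred m hm)
  -- On the support of `y`, the map `m ↦ (P m).1` is injective: two members of equal index `i` with
  -- `y (i - 1) ≠ 0` have the same unit. Being onto, it makes the support closed under predecessors,
  -- hence everything; multiplying the relations around the cycle then cancels `∏ y`.
  let φ : {m // y m ≠ 0} → {m // y m ≠ 0} := fun m => ⟨(P m.1).1, hself m.1 m.2⟩
  have hφ : Function.Injective φ := by
    rintro ⟨m, hm⟩ ⟨m', hm'⟩ h
    have h1 : (P m).1 = (P m').1 := congrArg Subtype.val h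
    have h2 := hy m
    have h3 := hy m'
    have h4 := hpred m hm
    have hPP : P m = P m' := by
      revert h1 h2 h3 h4
      generalize P m = p
      generalize P m' = p'
      obtain ⟨i, j⟩ := p
      obtain ⟨i', j'⟩ := p'
      intro h1 h2 h3 h4
      obtain rfl : i = i' := h1
      have h5 : (r i j : F) = r i j' := mul_right_cancel₀ h4 (h2.symm.trans h3)
      rw [hr i (Units.ext h5)]
    exact Subtype.ext (hP.1 hPP)
  have hsurj := Finite.surjective_of_injective hφ
  have hall : ∀ l, y l ≠ 0 := by
    refine finRotate_induction (p := fun l => y l ≠ 0) (fun l hl => ?_) hk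
    obtain ⟨m, hm⟩ := hsurj ⟨l, hl⟩
    have h1 : (P m.1).1 = l := congrArg Subtype.val hm
    exact h1 ▸ hpred m.1 m.2
  have hrec : ∀ i, ∃ j, y i = r i j * y ((finRotate ω).symm i) := by
    intro i
    obtain ⟨m, hm⟩ := hsurj ⟨i, hall i⟩
    have h1 : (P m.1).1 = i := congrArg Subtype.val hm
    subst h1
    exact ⟨_, hy m.1⟩
  choose j hj using hrec
  apply hprod j
  have h1 : ∏ i, y i = (∏ i, (r i (j i) : F)) * ∏ i, y i := by
    conv_lhs => rw [Finset.prod_congr rfl fun i _ => hj i]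
    rw [Finset.prod_mul_distrib, Equiv.prod_comp (finRotate ω).symm]
  ext
  rw [Units.coe_prod, Units.val_one]
  exact (mul_eq_right₀ (Finset.prod_ne_zero_iff.2 fun i _ => hall i)).1 h1.symm

/-- A transversal none of whose members other than `P k = p` can be reached through `u k`. -/
theorem exists_avoiding (hω : 3 ≤ ω) (hd : ∀ i, 2 ≤ d i) (p : Σ i : Fin ω, Fin (d i)) (k : Fin ω)
    (hk : p.1 = k ∨ p.1 = finRotate ω k) :
    ∃ P, IsTransversal P ∧ P k = p ∧
      ∀ m ≠ k, (P m).1 ≠ k ∧ (finRotate ω).symm (P m).1 ≠ k := by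
  have h1 : finRotate ω k ≠ k := finRotate_ne (by omega) k
  have h2 : finRotate ω (finRotate ω k) ≠ k := finRotate_finRotate_ne hω k
  have h3 : finRotate ω (finRotate ω k) ≠ finRotate ω k := finRotate_ne (by omega) _
  -- The default choice at `m` is `n m 0`. At `k + 1` that node is adjacent to `u k`, so the second
  -- node at `k + 2` replaces it.
  let P : Fin ω → Σ i : Fin ω, Fin (d i) := fun m =>
    if m = k then p else
      if m = finRotate ω k then ⟨finRotate ω (finRotate ω k), ⟨1, hd _⟩⟩
      else ⟨m, ⟨0, by have := hd m; omega⟩⟩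
  have hPk : P k = p := if_pos rfl
  have hPk' : P (finRotate ω k) = ⟨finRotate ω (finRotate ω k), ⟨1, hd _⟩⟩ := by
    simp only [P, if_neg h1, if_true]
  have hPm : ∀ m, m ≠ k → m ≠ finRotate ω k →
      P m = ⟨m, ⟨0, by have := hd m; omega⟩⟩ := by
    intro m hm hm'
    simp only [P, if_neg hm, if_neg hm']
  have hfst : ∀ m ≠ k, (P m).1 ≠ k ∧ (P m).1 ≠ finRotate ω k := by
    intro m hm
    by_cases hm' : m = finRotate ω k
    · rw [hm', hPk']
      exact ⟨h2, h3⟩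
    · rw [hPm m hm hm']
      exact ⟨hm, hm'⟩
  refine ⟨P, ⟨?_, ?_⟩, hPk, ?_⟩
  · have hkm : ∀ m ≠ k, P k ≠ P m := by
      intro m hm h
      rw [hPk] at h
      rcases hk with hk | hk
      · exact (hfst m hm).1 (h ▸ hk)
      · exact (hfst m hm).2 (h ▸ hk)
    have hkm' : ∀ m, m ≠ k → m ≠ finRotate ω k → P (finRotate ω k) ≠ P m := by
      intro m hm hm' h
      rw [hPk', hPm m hm hm'] at h
      obtain ⟨h4, h5⟩ := Sigma.mk.inj_iff.1 h
      subst h4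
      have := congrArg Fin.val (eq_of_heq h5)
      simp at this
    intro m m' h
    by_contra hne
    by_cases hm : m = k
    · subst hm
      exact hkm m' (Ne.symm hne) h
    by_cases hm' : m' = k
    · subst hm'
      exact hkm m hne h.symm
    by_cases hn : m = finRotate ω k
    · subst hn
      exact hkm' m' hm' (Ne.symm hne) h
    by_cases hn' : m' = finRotate ω k
    · subst hn'
      exact hkm' m hm hne h.symm
    rw [hPm m hm hn, hPm m' hm' hn'] at h
    exact hne (Sigma.mk.inj_iff.1 h).1
  · intro m
    by_cases hm : m = k
    · subst hm
      rwa [hPk]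
    by_cases hm' : m = finRotate ω k
    · subst hm'
      rw [hPk']
      exact Or.inr rfl
    · rw [hPm m hm hm']
      exact Or.inl rfl
  · intro m hm
    refine ⟨(hfst m hm).1, fun h => (hfst m hm).2 ?_⟩
    rw [← h, Equiv.apply_symm_apply]

/-- A transversal with two given members of equal index. -/
theorem exists_pair (hω : 3 ≤ ω) (hd : ∀ i, 2 ≤ d i) {i : Fin ω} {j j' : Fin (d i)}
    (hj : j ≠ j') :
    ∃ P, IsTransversal P ∧ P i = ⟨i, j⟩ ∧ P ((finRotate ω).symm i) = ⟨i, j'⟩ := by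
  have h1 : (finRotate ω).symm i ≠ i := fun h =>
    finRotate_ne (by omega) i (by conv_lhs => rw [← h, Equiv.apply_symm_apply])
  let P : Fin ω → Σ i : Fin ω, Fin (d i) := fun m =>
    if m = i then ⟨i, j⟩ else
      if m = (finRotate ω).symm i then ⟨i, j'⟩ else ⟨m, ⟨0, by have := hd m; omega⟩⟩
  have hPi : P i = ⟨i, j⟩ := if_pos rfl
  have hPi' : P ((finRotate ω).symm i) = ⟨i, j'⟩ := by simp only [P, if_neg h1, if_true]
  have hPm : ∀ m, m ≠ i → m ≠ (finRotate ω).symm i →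
      P m = ⟨m, ⟨0, by have := hd m; omega⟩⟩ := by
    intro m hm hm'
    simp only [P, if_neg hm, if_neg hm']
  have hne : ∀ m, m ≠ i → m ≠ (finRotate ω).symm i → (P m).1 ≠ i := by
    intro m hm hm'
    rwa [hPm m hm hm']
  have hjj : P i ≠ P ((finRotate ω).symm i) := by
    rw [hPi, hPi']
    exact fun h => hj (eq_of_heq (Sigma.mk.inj_iff.1 h).2)
  have hfst : (P i).1 = i := by rw [hPi]
  have hfst' : (P ((finRotate ω).symm i)).1 = i := by rw [hPi']
  refine ⟨P, ⟨?_, ?_⟩, hPi, hPi'⟩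
  · intro m m' h
    by_contra hcon
    by_cases hm : m = i
    · subst hm
      by_cases hm' : m' = (finRotate ω).symm m
      · subst hm'
        exact hjj h
      · exact hne m' (Ne.symm hcon) hm' (h ▸ hfst)
    by_cases hn : m = (finRotate ω).symm i
    · subst hn
      by_cases hm' : m' = i
      · subst hm'
        exact hjj h.symm
      · exact hne m' hm' (Ne.symm hcon) (h ▸ hfst')
    have h2 := hne m hm hn
    by_cases hm' : m' = i
    · subst hm'
      exact h2 (h ▸ hfst)
    by_cases hn' : m' = (finRotate ω).symm i
    · subst hn'
      exact h2 (h ▸ hfst')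
    rw [hPm m hm hn, hPm m' hm' hn'] at h
    exact hcon (Sigma.mk.inj_iff.1 h).1
  · intro m
    by_cases hm : m = i
    · subst hm
      exact Or.inl hfst
    by_cases hm' : m = (finRotate ω).symm i
    · subst hm'
      rw [hfst', Equiv.apply_symm_apply]
      exact Or.inr rfl
    · rw [hPm m hm hm']
      exact Or.inl rfl

end IsTransversal

/-- Partial products solve the recurrence `y (k + 1) = r (k + 1) * y k`; total product `1` is what
makes it close up from the last index to `0`. -/
theorem prod_Iic_finRotate {F : Type*} [CommMonoid F] {n : ℕ} (r : Fin (n + 1) → F)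
    (h : ∏ i, r i = 1) (k : Fin (n + 1)) :
    ∏ i ∈ Finset.Iic (finRotate (n + 1) k), r i =
      r (finRotate (n + 1) k) * ∏ i ∈ Finset.Iic k, r i := by
  induction k using Fin.lastCases with
  | last =>
    rw [finRotate_last]
    have h1 : Finset.Iic (Fin.last n) = Finset.univ := by
      ext i
      simp [Fin.le_last]
    have h2 : Finset.Iic (0 : Fin (n + 1)) = {0} := by
      ext i
      simp
    rw [h1, h2, h, Finset.prod_singleton, mul_one]
  | cast k =>
    have h1 : finRotate (n + 1) k.castSucc = k.succ := by
      rw [finRotate_apply, Fin.coeSucc_eq_succ]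
    have h2 : Finset.Iic k.succ = insert k.succ (Finset.Iic k.castSucc) := by
      ext i
      simp only [Finset.mem_Iic, Finset.mem_insert, Fin.le_iff_val_le_val, Fin.ext_iff,
        Fin.val_succ, Fin.val_castSucc]
      omega
    rw [h1, h2, Finset.prod_insert]
    simp [Fin.le_iff_val_le_val]

/-- Vectors `b p • e (p.1) + a p • e (p.1 - 1)` every transversal of which has trivial left kernel
give a family of units without transversal of product `1`. -/
theorem hasTransversalFreeFamily_of_forall {F : Type*} [Field F] (hω : 3 ≤ ω) (hd : ∀ i, 2 ≤ d i)
    (b a : (Σ i : Fin ω, Fin (d i)) → F)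
    (h : ∀ P : Fin ω → Σ i : Fin ω, Fin (d i), IsTransversal P → ∀ y : Fin ω → F,
      (∀ m, b (P m) * y (P m).1 + a (P m) * y ((finRotate ω).symm (P m).1) = 0) → y = 0) :
    HasTransversalFreeFamily F d := by
  have hsym : ∀ i : Fin ω, (finRotate ω).symm i ≠ i := fun i h =>
    finRotate_ne (by omega) i (by conv_lhs => rw [← h, Equiv.apply_symm_apply])
  -- The coefficient of `p` at `u k` is nonzero: otherwise the unit vector at `k` would be in the
  -- left kernel of a transversal in which only `p` is adjacent to `u k`.
  have hcoeff : ∀ (p : Σ i : Fin ω, Fin (d i)) (k : Fin ω), (p.1 = k ∨ p.1 = finRotate ω k) →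
      b p * (Pi.single k 1 : Fin ω → F) p.1 +
        a p * (Pi.single k 1 : Fin ω → F) ((finRotate ω).symm p.1) ≠ 0 := by
    intro p k hk h0
    obtain ⟨P, hP, hPk, hm⟩ := IsTransversal.exists_avoiding hω hd p k hk
    have h1 := h P hP (Pi.single k 1) fun m => by
      by_cases hmk : m = k
      · rw [hmk, hPk, h0]
      · rw [Pi.single_eq_of_ne (hm m hmk).1, Pi.single_eq_of_ne (hm m hmk).2]
        simp
    exact one_ne_zero (α := F) (by simpa using congrFun h1 k)
  have hb : ∀ p, b p ≠ 0 := by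
    intro p
    have := hcoeff p p.1 (Or.inl rfl)
    rwa [Pi.single_eq_same, Pi.single_eq_of_ne (hsym _), mul_one, mul_zero, add_zero] at this
  have ha : ∀ p, a p ≠ 0 := by
    intro p
    have := hcoeff p ((finRotate ω).symm p.1) (Or.inr (Equiv.apply_symm_apply _ _).symm)
    rwa [Pi.single_eq_same, Pi.single_eq_of_ne (hsym _).symm, mul_one, mul_zero, zero_add] at this
  have hne : ∀ p, -(a p / b p) ≠ 0 := fun p => neg_ne_zero.2 (div_ne_zero (ha p) (hb p))
  refine ⟨fun i j => Units.mk0 (-(a ⟨i, j⟩ / b ⟨i, j⟩)) (hne _), fun i j j' hjj => ?_,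
    fun j hj => ?_⟩
  · by_contra hcon
    obtain ⟨P, hP, hPi, hPi'⟩ := IsTransversal.exists_pair hω hd hcon
    -- Equal ratios make rows `i` and `i - 1` of this square system proportional, so it cannot take
    -- the values `1` and `0` there, although it is injective and hence onto.
    let f : (Fin ω → F) →ₗ[F] (Fin ω → F) := LinearMap.pi fun m =>
      b (P m) • LinearMap.proj (P m).1 + a (P m) • LinearMap.proj ((finRotate ω).symm (P m).1)
    have hf : Function.Injective f := by
      rw [← LinearMap.ker_eq_bot, LinearMap.ker_eq_bot']
      intro y hy
      refine h P hP y fun m => ?_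
      simpa [f] using congrFun hy m
    obtain ⟨y, hy⟩ := LinearMap.injective_iff_surjective.1 hf (Pi.single i 1)
    have e1 := congrFun hy i
    have e2 := congrFun hy ((finRotate ω).symm i)
    rw [Pi.single_eq_same] at e1
    rw [Pi.single_eq_of_ne (hsym i)] at e2
    simp only [f, LinearMap.pi_apply, LinearMap.add_apply, LinearMap.smul_apply,
      LinearMap.proj_apply, smul_eq_mul, hPi, hPi'] at e1 e2
    have e3 := congrArg Units.val hjj
    simp only [Units.val_mk0, neg_inj] at e3
    rw [div_eq_div_iff (hb _) (hb _)] at e3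
    apply hb ⟨i, j'⟩
    linear_combination (-b ⟨i, j'⟩) * e1 + b ⟨i, j⟩ * e2 + y ((finRotate ω).symm i) * e3
  · obtain ⟨n, rfl⟩ := Nat.exists_eq_add_of_le' (show 1 ≤ ω by omega)
    set r : Fin (n + 1) → F := fun i => -(a ⟨i, j i⟩ / b ⟨i, j i⟩) with hr
    have hr1 : ∏ i, r i = 1 := by
      have := congrArg Units.val hj
      simpa [Units.coe_prod, hr] using this
    have h1 := h (fun m => ⟨m, j m⟩)
      ⟨fun m m' h => (Sigma.mk.inj_iff.1 h).1, fun m => Or.inl rfl⟩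
      (fun k => ∏ i ∈ Finset.Iic k, r i) fun m => by
        have h2 := prod_Iic_finRotate r hr1 ((finRotate (n + 1)).symm m)
        rw [Equiv.apply_symm_apply] at h2
        have h3 : b ⟨m, j m⟩ * r m = -a ⟨m, j m⟩ := by
          rw [hr, mul_neg, mul_div_cancel₀ _ (hb _)]
        simp only [h2]
        rw [← mul_assoc, h3]
        ring
    have h3 := congrFun h1 0
    exact absurd h3 (Finset.prod_ne_zero_iff.2 fun i _ => hne _)

/-! ### Maximum flow and transversals -/

/-- A path of the core network to layer-4 nodes traverses `u k` and ends at some `n i j` with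
`i = k` or `i = k + 1`. -/
theorem exists_of_isPathTo {N : Finset (Σ i : Fin ω, Fin (d i))} {l : List (CoreEdge ω d)}
    (h : (coreNetwork ω d).IsPathTo {x | ∃ p ∈ N, x = .n p.1 p.2} l) :
    ∃ k, ∃ p ∈ N, CoreEdge.su k ∈ l ∧ CoreEdge.vn p.1 p.2 ∈ l ∧
      (p.1 = k ∨ p.1 = finRotate ω k) := by
  obtain ⟨hchain, ⟨e, he, hes⟩, ⟨e', he', p, hp, hpe⟩⟩ := h
  change e.tail = CoreNode.s at hes
  change e'.head = CoreNode.n p.1 p.2 at hpe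
  have hvn : e' = .vn p.1 p.2 := by
    cases e' with
    | vn i j =>
      simp only [CoreEdge.head, CoreNode.n.injEq] at hpe
      obtain ⟨rfl, h⟩ := hpe
      rw [eq_of_heq h]
    | _ => simp [CoreEdge.head] at hpe
  subst hvn
  cases e with
  | su k =>
    refine ⟨k, p, hp, List.mem_of_mem_head? he, List.mem_of_mem_getLast? he', ?_⟩
    match l, hchain, he, he' with
    | [e1], hchain, he, he' => simp at he he'; rw [he] at he'; simp at he'
    | [e1, e2], hchain, he, he' =>
      simp at he he'
      subst he he'
      simp [coreNetwork, CoreEdge.head, CoreEdge.tail] at hchain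
    | e1 :: e2 :: e3 :: t, hchain, he, he' =>
      simp only [List.isChain_cons_cons] at hchain
      obtain ⟨h12, h23, hrest⟩ := hchain
      simp only [List.head?_cons, Option.mem_def, Option.some.injEq] at he
      subst he
      change CoreNode.u k = e2.tail at h12
      change e2.head = e3.tail at h23
      have key : ∀ i, e2.head = CoreNode.v i → (i = k ∨ i = finRotate ω k) →
          (p.1 = k ∨ p.1 = finRotate ω k) := by
        intro i hi hik
        rw [hi] at h23
        cases e3 with
        | vn i' j' =>
          simp only [CoreEdge.tail, CoreNode.v.injEq] at h23
          subst h23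
          cases t with
          | nil =>
            simp only [List.getLast?_cons_cons, List.getLast?_singleton, Option.mem_def,
              Option.some.injEq, CoreEdge.vn.injEq] at he'
            rwa [← he'.1]
          | cons e4 t =>
            simp only [List.isChain_cons_cons] at hrest
            have h34 : CoreNode.n i j' = e4.tail := hrest.1
            cases e4 <;> simp [CoreEdge.tail] at h34
        | _ => simp [CoreEdge.tail] at h23
      cases e2 with
      | uv i =>
        simp only [CoreEdge.tail, CoreNode.u.injEq] at h12
        exact key i rfl (Or.inl h12.symm)
      | uv' i =>
        simp only [CoreEdge.tail, CoreNode.u.injEq] at h12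
        exact key i rfl (Or.inr (by rw [h12, Equiv.apply_symm_apply]))
      | _ => simp [CoreEdge.tail] at h12
  | _ => simp [CoreEdge.tail] at hes

theorem maxflow_le (N : Finset (Σ i : Fin ω, Fin (d i))) :
    (coreNetwork ω d).maxflow {x | ∃ p ∈ N, x = .n p.1 p.2} ≤ ω := by
  refine csSup_le' ?_
  rintro k ⟨P, hP, hd⟩
  choose κ p hp hκ hvn hadj using fun i => exists_of_isPathTo (hP i)
  have hinj : Function.Injective κ := fun i j hij => by
    by_contra hne
    exact hd hne (hκ i) (hij ▸ hκ j)
  simpa using Fintype.card_le_of_injective κ hinj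

/-- Every receiver is given by a transversal. -/
theorem exists_isTransversal_of_maxflow {N : Finset (Σ i : Fin ω, Fin (d i))} (hN : N.card = ω)
    (h : (coreNetwork ω d).maxflow {x | ∃ p ∈ N, x = .n p.1 p.2} = ω) :
    ∃ P, IsTransversal P ∧ Finset.univ.image P = N := by
  have hmem := Nat.sSup_mem (s := {k | (coreNetwork ω d).HasDisjointPaths
    {x | ∃ p ∈ N, x = .n p.1 p.2} k}) ⟨0, Fin.elim0, fun i => i.elim0, fun i => i.elim0⟩
    (SourcedNetwork.bddAbove_hasDisjointPaths _ _)
  change (coreNetwork ω d).HasDisjointPaths _ ((coreNetwork ω d).maxflow _) at hmem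
  rw [h] at hmem
  obtain ⟨Q, hQ, hdis⟩ := hmem
  -- Edge-disjointness makes both the source edges `su (κ i)` and the final edges into `p i`
  -- distinct. So `κ` is a permutation, and the `p i` reindexed by it form the transversal.
  choose κ p hp hκ hvn hadj using fun i => exists_of_isPathTo (hQ i)
  have hinj : Function.Injective κ := fun i j hij => by
    by_contra hne
    exact hdis hne (hκ i) (hij ▸ hκ j)
  have hpinj : Function.Injective p := fun i j hij => by
    by_contra hne
    exact hdis hne (hvn i) (hij ▸ hvn j)
  let e := Equiv.ofBijective κ (Finite.injective_iff_bijective.1 hinj)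
  have hPinj : Function.Injective (p ∘ e.symm) := hpinj.comp e.symm.injective
  refine ⟨p ∘ e.symm, ⟨hPinj, fun m => ?_⟩, ?_⟩
  · have h1 : κ (e.symm m) = m := e.apply_symm_apply m
    have h2 := hadj (e.symm m)
    rwa [h1] at h2
  · refine Finset.eq_of_subset_of_card_le ?_ ?_
    · intro x hx
      obtain ⟨m, -, rfl⟩ := Finset.mem_image.1 hx
      exact hp _
    · rw [Finset.card_image_of_injective _ hPinj, hN, Finset.card_univ, Fintype.card_fin]

/-- Every transversal gives a receiver. -/
theorem IsTransversal.maxflow_eq {P : Fin ω → Σ i : Fin ω, Fin (d i)} (hP : IsTransversal P) :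
    (coreNetwork ω d).maxflow {x | ∃ p ∈ Finset.univ.image P, x = .n p.1 p.2} = ω := by
  refine le_antisymm (maxflow_le _) (le_csSup (SourcedNetwork.bddAbove_hasDisjointPaths _ _) ?_)
  let Q : Fin ω → List (CoreEdge ω d) := fun m =>
    [.su m, if (P m).1 = m then .uv (P m).1 else .uv' (P m).1, .vn (P m).1 (P m).2]
  refine ⟨Q, fun m => ⟨?_, ⟨.su m, by simp [Q], rfl⟩, ⟨.vn (P m).1 (P m).2, by simp [Q], P m,
    Finset.mem_image_of_mem _ (Finset.mem_univ m), rfl⟩⟩, ?_⟩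
  · by_cases h : (P m).1 = m
    · simp [Q, h, coreNetwork, CoreEdge.head, CoreEdge.tail]
    · have h' := (hP.2 m).resolve_left h
      simp only [Q, if_neg h, coreNetwork, CoreEdge.head, CoreEdge.tail, List.isChain_cons_cons,
        List.isChain_singleton, and_true]
      rw [h', Equiv.symm_apply_apply]
  · intro m m' hne
    rw [List.disjoint_left]
    intro x hx hx'
    have hvn : ¬ (CoreEdge.vn (P m).1 (P m).2 = .vn (P m').1 (P m').2) := by
      intro h
      simp only [CoreEdge.vn.injEq] at h
      exact hne (hP.1 (Sigma.ext h.1 h.2))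
    have hm : (P m).1 ≠ m → (P m).1 = finRotate ω m := (hP.2 m).resolve_left
    have hm' : (P m').1 ≠ m' → (P m').1 = finRotate ω m' := (hP.2 m').resolve_left
    simp only [Q, List.mem_cons, List.not_mem_nil, or_false] at hx hx'
    rcases hx with rfl | rfl | rfl
    · split_ifs at hx' <;> simp [hne] at hx'
    · by_cases h : (P m).1 = m <;> by_cases h' : (P m').1 = m'
      · simp [h, h', hne] at hx'
      · simp [h, h'] at hx'
      · simp [h, h'] at hx'
      · simp only [if_neg h, if_neg h', reduceCtorEq, CoreEdge.uv'.injEq, false_or,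
          or_false] at hx'
        rw [hm h, hm' h'] at hx'
        exact hne ((finRotate ω).injective hx')
    · split_ifs at hx' <;> simp at hx' <;> exact hvn (by simpa using hx')

theorem IsTransversal.card_image {P : Fin ω → Σ i : Fin ω, Fin (d i)} (hP : IsTransversal P) :
    (Finset.univ.image P).card = ω := by
  rw [Finset.card_image_of_injective _ hP.1, Finset.card_univ, Fintype.card_fin]

end Transversal

/-! ### Full rank expressed by linear forms -/

theorem Matrix.rank_eq_card_iff_forall_dual {F m n : Type*} [Field F] {_ : Fintype m}
    {_ : Fintype n} (M : Matrix m n F) : M.rank = Fintype.card m ↔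
      ∀ φ : (m → F) →ₗ[F] F, (∀ e, φ (fun o => M o e) = 0) → φ = 0 := by
  classical
  have h1 : (∀ φ : (m → F) →ₗ[F] F, (∀ e, φ (fun o => M o e) = 0) → φ = 0) ↔
      LinearIndependent F M.row := by
    rw [← Matrix.vecMul_injective_iff, ← Matrix.coe_vecMulLinear, ← LinearMap.ker_eq_bot,
      LinearMap.ker_eq_bot']
    constructor
    · intro h x hx
      have h2 := h (∑ o, x o • LinearMap.proj o) fun e => by
        have := congrFun hx e
        simpa [Matrix.vecMul, dotProduct] using this
      funext o
      have h3 := LinearMap.congr_fun h2 (Pi.single o 1)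
      simpa [Pi.single_apply] using h3
    · intro h φ hφ
      have h2 := h (fun o => φ (Pi.single o 1)) (by
        funext e
        have := hφ e
        rw [LinearMap.pi_apply_eq_sum_univ] at this
        simp only [smul_eq_mul] at this
        refine Eq.trans ?_ this
        simp only [Matrix.coe_vecMulLinear, Matrix.vecMul, dotProduct]
        refine Finset.sum_congr rfl fun o _ => ?_
        rw [mul_comm]
        congr 2
        ext o'
        simp [Pi.single_apply, eq_comm])
      refine LinearMap.pi_ext' fun o => ?_
      ext
      exact congrFun h2 o
  rw [h1]
  refine ⟨fun h => ?_, fun h => h.rank_matrix⟩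
  rw [linearIndependent_iff_card_eq_finrank_span, ← h, Matrix.rank_eq_finrank_span_row]
  rfl

/-- Linear solvability in terms of linear forms vanishing on the coding vectors. -/
theorem MulticastNetwork.linearlySolvable_iff {V E F : Type*} [Finite V] [Finite E] [Fintype E]
    [Field F] (𝒩 : MulticastNetwork V E) : 𝒩.LinearlySolvable F ↔
      ∃ (c : 𝒩.LinearCode F) (f : E → 𝒩.SourceEdge → F),
        (∀ e o : 𝒩.SourceEdge, (o = e → f e o = 1) ∧ (o ≠ e → f e o = 0)) ∧
        (∀ e, 𝒩.tail e ≠ 𝒩.source → f e = ∑ e', c.coeff e' e • f e') ∧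
        ∀ t ∈ 𝒩.receivers, ∀ φ : (𝒩.SourceEdge → F) →ₗ[F] F,
          (∀ e, 𝒩.head e = t → φ (f e) = 0) → φ = 0 := by
  classical
  unfold LinearlySolvable SourcedNetwork.LinearCode.IsCodingVectors
  refine exists_congr fun c => exists_congr fun f => ?_
  rw [and_assoc]
  refine and_congr ?_ (and_congr_right' (forall₂_congr fun t _ => ?_))
  · refine forall_congr' fun e => ?_
    rw [funext_iff]
    refine forall_congr' fun o => ?_
    by_cases h : o = e
    · subst h
      simp
    · simp [h]
  · rw [Matrix.rank_eq_card_iff_forall_dual]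
    refine forall_congr' fun φ => ?_
    simp only [Matrix.of_apply, Subtype.forall]

/-! ### Linear codes on the five-layer network -/

namespace fiveLayerNetwork

variable {ω : ℕ} {d : Fin ω → ℕ}

/-- The source edge entering `u k`. -/
def srcEdge (k : Fin ω) : (fiveLayerNetwork ω d).SourceEdge := ⟨.inl (.su k), rfl⟩

theorem srcEdge_bijective :
    Function.Bijective (srcEdge : Fin ω → (fiveLayerNetwork ω d).SourceEdge) := by
  constructor
  · intro k l h
    have := congrArg Subtype.val h
    simpa [srcEdge] using this
  · rintro ⟨e, he⟩
    change Sum.elim (fun e : CoreEdge ω d => (.inl e.tail : FullNode ω d)) _ e = .inl .s at he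
    rcases e with (k | _ | _ | _) | x
    · exact ⟨k, rfl⟩
    all_goals simp [CoreEdge.tail] at he

/-- A family of vectors satisfying the local conditions is given by a linear code. -/
theorem exists_linearCode {V E F : Type*} [Finite V] [Finite E] [Fintype E] [Field F]
    (𝒩 : SourcedNetwork V E) (f : E → 𝒩.SourceEdge → F)
    (h : ∀ e, 𝒩.tail e ≠ 𝒩.source → ∃ k : E → F, (∀ e', 𝒩.head e' ≠ 𝒩.tail e → k e' = 0) ∧
      f e = ∑ e', k e' • f e') :
    ∃ c : 𝒩.LinearCode F, ∀ e, 𝒩.tail e ≠ 𝒩.source → f e = ∑ e', c.coeff e' e • f e' := by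
  classical
  choose k hk hf using h
  refine ⟨⟨fun e' e => if he : 𝒩.tail e ≠ 𝒩.source then k e he e' else 0, fun e' e hne => ?_⟩,
    fun e he => ?_⟩
  · split_ifs with he
    · exact hk e he e' hne
    · rfl
  · simpa only [dif_pos he] using hf e he

open Classical in
/-- The coding vectors of a solution given by a family of units. -/
noncomputable def vec {F : Type*} [Field F] (r : ∀ i, Fin (d i) → Fˣ) :
    FullEdge ω d → (fiveLayerNetwork ω d).SourceEdge → F
  | .inl (.su k) => Pi.single (srcEdge k) 1
  | .inl (.uv k) => Pi.single (srcEdge k) 1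
  | .inl (.uv' k) => Pi.single (srcEdge ((finRotate ω).symm k)) 1
  | .inl (.vn i j) => Pi.single (srcEdge i) 1 -
      (r i j : F) • Pi.single (srcEdge ((finRotate ω).symm i)) 1
  | .inr x => Pi.single (srcEdge x.2.1.1) 1 -
      (r x.2.1.1 x.2.1.2 : F) • Pi.single (srcEdge ((finRotate ω).symm x.2.1.1)) 1

theorem exists_coeff {F : Type*} [Field F] (r : ∀ i, Fin (d i) → Fˣ) (e : FullEdge ω d)
    (he : (fiveLayerNetwork ω d).tail e ≠ (fiveLayerNetwork ω d).source) :
    ∃ k : FullEdge ω d → F,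
      (∀ e', (fiveLayerNetwork ω d).head e' ≠ (fiveLayerNetwork ω d).tail e → k e' = 0) ∧
      vec r e = ∑ e', k e' • vec r e' := by
  classical
  have single : ∀ e₀ : FullEdge ω d,
      (fiveLayerNetwork ω d).head e₀ = (fiveLayerNetwork ω d).tail e → vec r e = vec r e₀ →
      ∃ k : FullEdge ω d → F,
        (∀ e', (fiveLayerNetwork ω d).head e' ≠ (fiveLayerNetwork ω d).tail e → k e' = 0) ∧
        vec r e = ∑ e', k e' • vec r e' := by
    intro e₀ h₀ hv
    refine ⟨Pi.single e₀ 1, fun e' h' => Pi.single_eq_of_ne ?_ _, ?_⟩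
    · rintro rfl
      exact h' h₀
    simp [Pi.single_apply, hv]
  rcases e with (k | k | k | ⟨i, j⟩) | x
  · exact absurd rfl he
  · exact single (.inl (.su k)) rfl rfl
  · exact single (.inl (.su ((finRotate ω).symm k))) rfl rfl
  · refine ⟨Pi.single (.inl (.uv i)) 1 + Pi.single (.inl (.uv' i)) (-(r i j : F)),
      fun e' h' => ?_, ?_⟩
    · rw [Pi.add_apply, Pi.single_eq_of_ne, Pi.single_eq_of_ne, add_zero] <;>
      · rintro rfl
        exact h' rfl
    · simp [Pi.single_apply, add_smul, Finset.sum_add_distrib, vec, sub_eq_add_neg]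
  · exact single (.inl (.vn x.2.1.1 x.2.1.2)) rfl rfl

theorem linearlySolvable_of_family {F : Type*} [Field F] (h : HasTransversalFreeFamily F d) :
    (fiveLayerNetwork ω d).LinearlySolvable F := by
  classical
  obtain ⟨r, hr, hprod⟩ := h
  obtain ⟨c, hc⟩ := exists_linearCode (fiveLayerNetwork ω d).toSourcedNetwork (vec r)
    (exists_coeff r)
  rw [MulticastNetwork.linearlySolvable_iff]
  refine ⟨c, vec r, fun e o => ?_, hc, ?_⟩
  · obtain ⟨k, rfl⟩ := srcEdge_bijective.2 e
    change (_ → (Pi.single (srcEdge k) 1 : _ → F) o = 1) ∧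
      (_ → (Pi.single (srcEdge k) 1 : _ → F) o = 0)
    exact ⟨by rintro rfl; exact Pi.single_eq_same _ _, fun h => Pi.single_eq_of_ne h _⟩
  · rintro _ ⟨⟨N, hN, hflow⟩, rfl⟩ φ hφ
    obtain ⟨P, hP, hPN⟩ := exists_isTransversal_of_maxflow hN hflow
    have hy : (fun k => φ (vec r (.inl (.su k)))) = 0 := by
      refine hP.eq_zero_of_recurrence hr hprod fun m => ?_
      have hm : P m ∈ N := hPN ▸ Finset.mem_image_of_mem _ (Finset.mem_univ m)
      have h1 := hφ (.inr ⟨⟨N, hN, hflow⟩, ⟨P m, hm⟩⟩) rfl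
      change φ (vec r (.inl (.su (P m).1)) -
        (r (P m).1 (P m).2 : F) • vec r (.inl (.su ((finRotate ω).symm (P m).1)))) = 0 at h1
      rw [map_sub, map_smul, sub_eq_zero] at h1
      exact h1
    have : Finite (fiveLayerNetwork ω d).SourceEdge := Subtype.finite
    refine LinearMap.pi_ext' fun e => LinearMap.ext_ring ?_
    obtain ⟨k, rfl⟩ := srcEdge_bijective.2 e
    rw [LinearMap.zero_comp, LinearMap.zero_apply]
    refine Eq.trans ?_ (congrFun hy k)
    change φ (Pi.single _ _) = φ (Pi.single _ _)
    -- The two sides differ only in the decidability instance used by `Pi.single`.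
    congr!

/-- Edges into receivers carry multiples of the layer-4 vectors, so a form killing the layer-4
vectors of a transversal kills everything entering its receiver and must vanish. -/
theorem family_of_linearlySolvable {F : Type*} [Field F] (hω : 3 ≤ ω) (hd : ∀ i, 2 ≤ d i)
    (h : (fiveLayerNetwork ω d).LinearlySolvable F) : HasTransversalFreeFamily F d := by
  classical
  rw [MulticastNetwork.linearlySolvable_iff] at h
  obtain ⟨c, f, hsrc, hf, hrank⟩ := h
  have hsu : ∀ k l : Fin ω, f (.inl (.su k)) (srcEdge l) = if l = k then 1 else 0 := by
    intro k l
    split_ifs with h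
    · exact (hsrc (srcEdge k) (srcEdge l)).1 (by rw [h])
    · exact (hsrc (srcEdge k) (srcEdge l)).2 fun h' => h (srcEdge_bijective.1 h')
  have hsingle : ∀ e e₀ : FullEdge ω d,
      (fiveLayerNetwork ω d).tail e ≠ (fiveLayerNetwork ω d).source →
      (∀ e', (fiveLayerNetwork ω d).head e' = (fiveLayerNetwork ω d).tail e → e' = e₀) →
      f e = c.coeff e₀ e • f e₀ := by
    intro e e₀ he h₀
    rw [hf e he]
    refine Fintype.sum_eq_single e₀ fun e' hne => ?_
    rw [c.coeff_eq_zero e' e fun h => hne (h₀ e' h), zero_smul]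
  have huv : ∀ k, f (.inl (.uv k)) =
      c.coeff (.inl (.su k)) (.inl (.uv k)) • f (.inl (.su k)) := by
    intro k
    refine hsingle _ _ (by simp [fiveLayerNetwork, CoreEdge.tail]) ?_
    rintro ((_ | _ | _ | _) | _) h <;>
      simp [fiveLayerNetwork, CoreEdge.tail, CoreEdge.head, -finRotate_symm_apply] at h
    rw [h]
  have huv' : ∀ k, f (.inl (.uv' k)) =
      c.coeff (.inl (.su ((finRotate ω).symm k))) (.inl (.uv' k)) •
        f (.inl (.su ((finRotate ω).symm k))) := by
    intro k
    refine hsingle _ _ (by simp [fiveLayerNetwork, CoreEdge.tail]) ?_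
    rintro ((_ | _ | _ | _) | _) h <;>
      simp [fiveLayerNetwork, CoreEdge.tail, CoreEdge.head, -finRotate_symm_apply] at h
    rw [h]
  have hvn : ∀ p : Σ i : Fin ω, Fin (d i), ∃ b a : F, f (.inl (.vn p.1 p.2)) =
      b • f (.inl (.su p.1)) + a • f (.inl (.su ((finRotate ω).symm p.1))) := by
    intro p
    refine ⟨c.coeff (.inl (.uv p.1)) (.inl (.vn p.1 p.2)) *
        c.coeff (.inl (.su p.1)) (.inl (.uv p.1)),
      c.coeff (.inl (.uv' p.1)) (.inl (.vn p.1 p.2)) *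
        c.coeff (.inl (.su ((finRotate ω).symm p.1))) (.inl (.uv' p.1)), ?_⟩
    rw [mul_smul, mul_smul, ← huv, ← huv', hf _ (by simp [fiveLayerNetwork, CoreEdge.tail])]
    refine Fintype.sum_eq_add _ _ (by simp) ?_
    rintro e' ⟨h1, h2⟩
    rw [c.coeff_eq_zero, zero_smul]
    intro h
    rcases e' with (_ | _ | _ | _) | _ <;>
      simp [fiveLayerNetwork, CoreEdge.tail, CoreEdge.head] at h h1 h2
    · exact h1 h
    · exact h2 h
  have hrecv : ∀ x : Σ N : ReceiverNode ω d, N.1, ∃ b : F,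
      f (.inr x) = b • f (.inl (.vn x.2.1.1 x.2.1.2)) := by
    intro x
    refine ⟨_, hsingle (.inr x) (.inl (.vn x.2.1.1 x.2.1.2)) (by simp [fiveLayerNetwork]) ?_⟩
    rintro ((_ | _ | _ | _) | _) h <;> simp [fiveLayerNetwork, CoreEdge.head] at h
    obtain ⟨rfl, h⟩ := h
    rw [eq_of_heq h]
  choose b a hba using hvn
  refine hasTransversalFreeFamily_of_forall hω hd b a fun P hP y hy => ?_
  let φ : ((fiveLayerNetwork ω d).SourceEdge → F) →ₗ[F] F :=
    ∑ k, y k • LinearMap.proj (srcEdge k)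
  have hφ : ∀ k, φ (f (.inl (.su k))) = y k := by
    intro k
    simp [φ, hsu]
  have h0 : φ = 0 := by
    refine hrank (.inr ⟨_, hP.card_image, hP.maxflow_eq⟩) ⟨_, rfl⟩ φ ?_
    rintro (e | ⟨N, p, hpN⟩) he
    · simp [fiveLayerNetwork] at he
    · obtain ⟨β, hβ⟩ := hrecv ⟨N, p, hpN⟩
      obtain rfl : N = ⟨_, hP.card_image, hP.maxflow_eq⟩ := Sum.inr_injective he
      obtain ⟨m, -, rfl⟩ := Finset.mem_image.1 hpN
      rw [hβ, hba, map_smul, map_add, map_smul, map_smul, hφ, hφ, smul_eq_mul, smul_eq_mul,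
        smul_eq_mul, hy m, mul_zero]
  funext k
  rw [← hφ k, h0]
  rfl

end fiveLayerNetwork

/-! ### The numerical bound and the main theorem -/

theorem ceil_div_eq_of_forall_le_iff {n h x : ℕ} (hh : 0 < h)
    (hx : ∀ z, x ≤ z ↔ n ≤ h * z) : ⌈(n : ℚ) / h⌉ = (x : ℤ) := by
  have hh' : (0 : ℚ) < h := by exact_mod_cast hh
  rw [Int.ceil_eq_iff, lt_div_iff₀ hh', div_le_iff₀ hh']
  constructor
  · cases x with
    | zero =>
      have : (0 : ℚ) ≤ n := Nat.cast_nonneg n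
      push_cast
      linarith
    | succ k =>
      have h1 : h * k < n := not_le.1 fun h => absurd ((hx k).2 h) (by omega)
      have h2 : (h : ℚ) * k < n := by exact_mod_cast h1
      push_cast
      linarith
  · have h1 := (hx x).1 le_rfl
    have h2 : (n : ℚ) ≤ h * x := by exact_mod_cast h1
    push_cast
    linarith

theorem theorem3 {K K' : Type*} [Field K] [Finite K] [Field K'] [Finite K']
    (q q' : ℕ) (hq : Nat.card K = q) (hq' : Nat.card K' = q')
    (G : Subgroup Kˣ) (hG_proper : G ≠ ⊤) (hG_nontrivial : G ≠ ⊥)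
    (hG : SubgroupOrderCondition G K')
    (d : ℕ) (hd : Nat.card G = d)
    (ω : ℕ) (hω : 3 ≤ ω)
    (hbound : ∀ d' : ℕ, 1 ≤ d' → d' < d → d' ∣ q' - 1 →
      (((q' : ℚ) - 1) / d' - ⌈((q : ℚ) - d - 1) / d'⌉) / ((⌈(d : ℚ) / d'⌉ : ℚ) - 1) + 1 ≤ (ω : ℚ)) :
    (fiveLayerNetwork ω (criterionTuple ω q d)).LinearlySolvable K ∧
      ¬ (fiveLayerNetwork ω (criterionTuple ω q d)).LinearlySolvable K' ∧
      (fiveLayerNetwork ω (criterionTuple ω q d)).IsQMin q := by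
  have hd2 : 2 ≤ d := by
    rw [← hd]
    exact (Subgroup.one_lt_card_iff_ne_bot G).2 hG_nontrivial
  -- A proper subgroup has index at least `2`. Hence `q - d - 1 ≥ d ≥ 2`, so every entry of the
  -- tuple exceeds `1`.
  have hdq : 2 * d + 1 ≤ q := by
    obtain ⟨m, hm⟩ := Subgroup.card_subgroup_dvd_card G
    rw [Nat.card_units, hq, hd] at hm
    have hm2 : 2 ≤ m := by
      by_contra h
      have hm' : m = 0 ∨ m = 1 := by omega
      have hq1 : 1 < q := hq ▸ Finite.one_lt_card
      rcases hm' with rfl | rfl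
      · omega
      · apply hG_proper
        rw [← Subgroup.card_eq_iff_eq_top, hd, Nat.card_units, hq]
        omega
    have := Nat.mul_le_mul_left d hm2
    omega
  have hfam : HasTransversalFreeFamily K (criterionTuple ω q d) := by
    rw [← hq, ← hd]
    exact HasTransversalFreeFamily.of_subgroup G (by omega)
  have htuple : ∀ i, 2 ≤ criterionTuple ω q d i := by
    intro i
    unfold criterionTuple
    split_ifs <;> omega
  refine ⟨fiveLayerNetwork.linearlySolvable_of_family hfam, fun hsol => ?_, ?_, ?_⟩
  · refine HasTransversalFreeFamily.not_of_bound (by omega) (by omega) (by omega) ?_ ?_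
      (fiveLayerNetwork.family_of_linearlySolvable hω htuple hsol)
    · intro H hH
      rcases hG H hH with h | h
      · exact Or.inl (hd ▸ h)
      · right
        rw [hq, hd] at h
        omega
    · intro h m x y hh hhd hm hx hy
      rw [hq'] at hm
      have h1 := hbound h hh hhd ⟨m, hm⟩
      have hq1 : 1 < q' := hq' ▸ Finite.one_lt_card
      have hh' : (0 : ℚ) < h := by exact_mod_cast hh
      have e1 : ((q : ℚ) - d - 1) = ((q - d - 1 : ℕ) : ℚ) := by
        rw [Nat.cast_sub (by omega), Nat.cast_sub (by omega), Nat.cast_one]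
      have e2 : ((q' : ℚ) - 1) / h = m := by
        rw [div_eq_iff hh'.ne', mul_comm, ← Nat.cast_mul, ← hm, Nat.cast_sub (by omega),
          Nat.cast_one]
      rw [e1, e2, ceil_div_eq_of_forall_le_iff hh hx, ceil_div_eq_of_forall_le_iff hh hy] at h1
      -- As `h < d`, the denominator `⌈d / h⌉ - 1` is positive and can be cleared.
      have hx2 : 2 ≤ x := by
        by_contra hcon
        have := (hx 1).1 (by omega)
        omega
      obtain ⟨x, rfl⟩ := Nat.exists_eq_add_of_le' hx2
      obtain ⟨w, rfl⟩ := Nat.exists_eq_add_of_le' hω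
      have hpos : (0 : ℚ) < x + 1 := by positivity
      push_cast at h1
      have h2 : ((m : ℚ) - y) / (x + 1) ≤ w + 2 := by
        have e3 : (x : ℚ) + 2 - 1 = x + 1 := by ring
        rw [e3] at h1
        linarith
      rw [div_le_iff₀ hpos] at h2
      have h3 : (m : ℚ) ≤ ((w + 2) * (x + 1) + y : ℕ) := by
        push_cast
        linarith
      exact_mod_cast h3
  -- `IsQMin` ranges over fields in `Type`, so `K` is replaced by a copy there.
  · refine ⟨Shrink.{0} K, inferInstance, inferInstance, ?_, ?_⟩
    · rw [← hq]
      exact Nat.card_congr (equivShrink.{0} K).symm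
    · exact fiveLayerNetwork.linearlySolvable_of_family
        (hfam.map (Shrink.ringEquiv.{0} K).symm.toRingHom)
  · rintro n ⟨F, _, _, hn, hsol⟩
    by_contra hlt
    rw [not_le, ← hn] at hlt
    refine HasTransversalFreeFamily.not_of_bound (by omega) (by omega) (by omega) ?_ ?_
      (fiveLayerNetwork.family_of_linearlySolvable hω htuple hsol)
    · intro H _
      omega
    · intro h m x y hh hhd hm hx hy
      have h1 := (hx x).1 le_rfl
      have h2 := (hy y).1 le_rfl
      have hF : 1 < Nat.card F := Finite.one_lt_card
      -- `h * m = |F| - 1 < q - 1 = d + (q - d - 1) ≤ h * (x + y)`, so `m ≤ (x - 1) + y`: for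
      -- smaller fields the bound holds whatever `ω` is.
      have h3 : h * m < h * (x + y) := by
        rw [mul_add]
        omega
      have h4 := Nat.lt_of_mul_lt_mul_left h3
      have hx1 : x - 1 ≤ (ω - 1) * (x - 1) := Nat.le_mul_of_pos_left _ (by omega)
      omega
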